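/- For $n\ge 0$, $m\in\{1,2\}$ and $l=1,2$, let $$V_l(x)=a_{l0}+\sum_{j=1}^m\big(\lambda_{lj}e^{2\pi i k_{lj}\cdot x}+\overline{\lambda_{lj}}\,e^{-2\pi i k_{lj}\cdot x}\big),\qquad x\in\mathbb R^n,$$ where $a_{l0}\in\mathbb R$, $\lambda_{lj}\in\mathbb C$, $k_{lj}\in\mathbb Z^n\setminus\{0\}$, and, for each $l$, the vectors $k_{lj}$ $(1\le j\le m)$ are pairwise non-parallel (vectors $u,w\neq0$ are parallel, $u\parallel w$, if $w=tu$ for some real $t\ne0$ of either sign). Let $\overline H_l:\mathbb R^n\to\mathbb R$ be the effective Hamiltonian of $\frac12|p|^2+V_l(x)$, that is, $\overline H_l(p)$ is the unique $c\in\mathbb R$ for which the cell problem $\frac12|p+Dv|^2+V_l(x)=c$ has a continuous $\mathbb Z^n$-periodic viscosity solution $v$. Write $V_1\sim V_2$ if there are $c\in\mathbb Q\setminus\{0\}$ and $x_0\in\mathbb R^n$ such that $V_1(x)=V_2\left(\frac xc+x_0\right)$ for all $x\in\mathbb R^n$. Then: (1) If $m=1$, then $\overline H_1\equiv\overline H_2$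 if and only if $V_1\sim V_2$. (2) Let $m=2$. (i) If $k_{11}\perp k_{12}$, then $\overline H_1\equiv\overline H_2$ if and only if $a_{10}=a_{20}$ and there is a permutation $\sigma$ of $\{1,2\}$ such that, for $j=1,2$, $|\lambda_{1j}|=|\lambda_{2\sigma(j)}|$, and $k_{1j}\parallel k_{2\sigma(j)}$ whenever $\lambda_{1j}\neq0$. (ii) If $k_{11}$ is not perpendicular to $k_{12}$, then $\overline H_1\equiv\overline H_2$ if and only if $V_1\sim V_2$. -/

import Mathlib

namespace InverseHomogenization

/-- The integer vector `z`, seen as a point of Euclidean space. -/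
noncomputable def intVec {n : ℕ} (z : Fin n → ℤ) : EuclideanSpace ℝ (Fin n) :=
  WithLp.toLp 2 (fun i => (z i : ℝ))

/-- Functions on `ℝⁿ` that are `ℤⁿ`-periodic, that is, functions on the flat torus `ℝⁿ/ℤⁿ`. -/
def IsZPeriodic {n : ℕ} (f : EuclideanSpace ℝ (Fin n) → ℝ) : Prop :=
  ∀ (z : Fin n → ℤ) (x : EuclideanSpace ℝ (Fin n)), f (x + intVec z) = f x

/-- `v` is a continuous, `ℤⁿ`-periodic viscosity solution of the cell problem
`H (p + Dv) + V = c`: it is a subsolution (tested by `C¹` functions touching from above) and a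
supersolution (tested by `C¹` functions touching from below). -/
structure IsCellSolution {n : ℕ} (H V : EuclideanSpace ℝ (Fin n) → ℝ)
    (p : EuclideanSpace ℝ (Fin n)) (c : ℝ) (v : EuclideanSpace ℝ (Fin n) → ℝ) : Prop where
  continuous : Continuous v
  periodic : IsZPeriodic v
  subsolution : ∀ φ : EuclideanSpace ℝ (Fin n) → ℝ, ContDiff ℝ 1 φ →
    ∀ x, IsLocalMax (fun y => v y - φ y) x → H (p + gradient φ x) + V x ≤ c
  supersolution : ∀ φ : EuclideanSpace ℝ (Fin n) → ℝ, ContDiff ℝ 1 φ →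
    ∀ x, IsLocalMin (fun y => v y - φ y) x → c ≤ H (p + gradient φ x) + V x

/-- The effective Hamiltonian of `H + V` at `p`: the constant `c` for which the cell problem
`H (p + Dv) + V = c` has a continuous periodic viscosity solution (for continuous coercive `H` and
continuous periodic `V` there is exactly one such constant). -/
noncomputable def effectiveHamiltonian {n : ℕ} (H V : EuclideanSpace ℝ (Fin n) → ℝ)
    (p : EuclideanSpace ℝ (Fin n)) : ℝ :=
  Classical.epsilon fun c : ℝ => ∃ v, IsCellSolution H V p c v

/-- The mechanical Hamiltonian `|p|² / 2`. -/
noncomputable def kinetic {n : ℕ} (p : EuclideanSpace ℝ (Fin n)) : ℝ := ‖p‖ ^ 2 / 2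

/-- Two nonzero vectors are parallel when each is a real multiple (of either sign) of the other. -/
def Parallel {n : ℕ} (u w : EuclideanSpace ℝ (Fin n)) : Prop :=
  ∃ t : ℝ, t ≠ 0 ∧ w = t • u

/-- The data of a real trigonometric polynomial on the torus with `m` mutually non-parallel
modes. -/
structure ModePotential (n m : ℕ) where
  /-- the mean -/
  a : ℝ
  /-- the amplitudes -/
  amp : Fin m → ℂ
  /-- the modes -/
  k : Fin m → Fin n → ℤ
  k_ne_zero : ∀ j, k j ≠ 0
  not_parallel : ∀ i j, i ≠ j → ¬ Parallel (intVec (k i)) (intVec (k j))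

namespace ModePotential

variable {n m : ℕ}

/-- `a + ∑ j, (λ_j exp (2πi k_j ⬝ x) + conj λ_j exp (-2πi k_j ⬝ x))`. -/
noncomputable def expansion (P : ModePotential n m) (x : EuclideanSpace ℝ (Fin n)) : ℂ :=
  (P.a : ℂ) + ∑ j, (P.amp j *
      Complex.exp (Complex.I * (2 * Real.pi * inner ℝ (intVec (P.k j)) x : ℝ)) +
    (starRingEnd ℂ) (P.amp j) *
      Complex.exp (-(Complex.I * (2 * Real.pi * inner ℝ (intVec (P.k j)) x : ℝ))))

/-- The potential, as a real function (see `coe_V`). -/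
noncomputable def V (P : ModePotential n m) (x : EuclideanSpace ℝ (Fin n)) : ℝ :=
  (P.expansion x).re

/-- The trigonometric polynomial takes real values. -/
theorem coe_V (P : ModePotential n m) (x : EuclideanSpace ℝ (Fin n)) :
    (P.V x : ℂ) = P.expansion x := by
  have h : (starRingEnd ℂ) (P.expansion x) = P.expansion x := by
    simp only [expansion, map_add, map_sum, map_mul, Complex.conj_ofReal, Complex.conj_conj,
      ← Complex.exp_conj, map_neg, Complex.conj_I, neg_mul, neg_neg]
    congr 1
    exact Finset.sum_congr rfl fun j _ => add_comm _ _
  exact Complex.conj_eq_iff_re.mp h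

end ModePotential

/-- The effective Hamiltonians of `|p|² / 2 + V₁` and `|p|² / 2 + V₂` coincide. -/
def SameEffectiveHamiltonian {n : ℕ} (V₁ V₂ : EuclideanSpace ℝ (Fin n) → ℝ) : Prop :=
  ∀ p, effectiveHamiltonian kinetic V₁ p = effectiveHamiltonian kinetic V₂ p

/-- `V₁ x = V₂ (x / c + x₀)` for all `x`, for some nonzero rational `c` and some `x₀`. -/
def RationallyEquivalent {n : ℕ} (V₁ V₂ : EuclideanSpace ℝ (Fin n) → ℝ) : Prop :=
  ∃ c : ℚ, c ≠ 0 ∧ ∃ x₀ : EuclideanSpace ℝ (Fin n), ∀ x, V₁ x = V₂ ((c : ℝ)⁻¹ • x + x₀)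

end InverseHomogenization

/-! The analytic basis is well-posedness of the cell problem. Existence comes from Perron's method
for the discounted equation and the limit of vanishing discount. Doubling of variables shows that
the constant is the same even for solutions on a larger torus `ℝⁿ/Nℤⁿ`. A smooth periodic function,
used as a test function, therefore bounds the effective Hamiltonian from both sides
(`effectiveHamiltonian_le`, `le_effectiveHamiltonian`).

Equivalence implies equality: if `v` solves the problem for `V₂` then `c * v (x / c + x₀)` solves it
for `V₁`, on a larger torus, when `c > 0`. Since the modes are linearly independent, a translation
produces any change of phases; so `V₂` is even up to translation, which reduces `c < 0` to `c > 0`,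
and only the absolute values of the amplitudes matter. Orthogonal modes separate into
one-dimensional problems that see a mode only through its unit direction, so each length may be
changed independently (`effectiveHamiltonian_phasePotential_of_orthogonal`).

Equality implies equivalence: expand at the momentum `τ Q` as `τ → ∞`. For nonresonant `Q` two
trigonometric correctors give `τ² |Q|² / 2 + a + τ⁻² ∑ r_j² |k_j|² / (Q · k_j)² + O(τ⁻⁴)`. The
constant term is the mean. As `Q` approaches the hyperplane orthogonal to `u`, the blow-up of the
next coefficient gives the squared amplitude carried by the direction `u`
(`eq_and_directionWeight_eq`). Means, amplitudes and directions thus agree up to a permutation, but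
this coefficient is blind to the lengths of the modes.

For two nonorthogonal modes the lengths are compared at a resonance
(`eq_or_eq_neg_of_sameEffectiveHamiltonian`). Choose `Q` with `Q · k₀ = Q · k₁`. The product of the
two modes then has a part that no corrector linear in `Q` can remove, and it adds a positive amount
to the `τ⁻²` coefficient. If the second potential rescales the two modes by factors of different
absolute value, it is nonresonant at `Q` and has no such term. The common factor is rational because
the modes are integral. -/

open Filter Topology

namespace InverseHomogenization

/-! ### Calculus of gradients in a Hilbert space. -/

section Gradient

variable {E : Type*} [NormedAddCommGroup E] [InnerProductSpace ℝ E] [CompleteSpace E]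

theorem hasGradientAt_add {f g : E → ℝ} {f' g' x : E} (hf : HasGradientAt f f' x)
    (hg : HasGradientAt g g' x) : HasGradientAt (fun y => f y + g y) (f' + g') x := by
  rw [hasGradientAt_iff_hasFDerivAt] at *
  rw [map_add]
  exact hf.add hg

theorem hasGradientAt_const_mul {f : E → ℝ} {f' x : E} (c : ℝ) (hf : HasGradientAt f f' x) :
    HasGradientAt (fun y => c * f y) (c • f') x := by
  rw [hasGradientAt_iff_hasFDerivAt] at *
  have h := hf.const_mul c
  rwa [map_smulₛₗ, conj_trivial]

theorem hasGradientAt_neg {f : E → ℝ} {f' x : E} (hf : HasGradientAt f f' x) :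
    HasGradientAt (fun y => - f y) (- f') x := by
  simpa using hasGradientAt_const_mul (-1) hf

theorem hasGradientAt_sub {f g : E → ℝ} {f' g' x : E} (hf : HasGradientAt f f' x)
    (hg : HasGradientAt g g' x) : HasGradientAt (fun y => f y - g y) (f' - g') x := by
  simpa [sub_eq_add_neg] using hasGradientAt_add hf (hasGradientAt_neg hg)

theorem hasGradientAt_norm_sub_sq (x₀ x : E) :
    HasGradientAt (fun y => ‖y - x₀‖ ^ 2) ((2 : ℝ) • (x - x₀)) x := by
  rw [hasGradientAt_iff_hasFDerivAt]
  have h := ((hasFDerivAt_id x).sub_const x₀).norm_sq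
  refine HasFDerivAt.congr_fderiv h ?_
  ext y
  simp

theorem hasGradientAt_comp {g : ℝ → ℝ} {g' : ℝ} {f : E → ℝ} {f' x : E}
    (hg : HasDerivAt g g' (f x)) (hf : HasGradientAt f f' x) :
    HasGradientAt (fun y => g (f y)) (g' • f') x := by
  rw [hasGradientAt_iff_hasFDerivAt] at *
  have h := hg.comp_hasFDerivAt x hf
  rwa [map_smulₛₗ, conj_trivial]

theorem hasGradientAt_inner (κ x : E) : HasGradientAt (fun y => inner ℝ κ y) κ x := by
  rw [hasGradientAt_iff_hasFDerivAt]
  exact (InnerProductSpace.toDual ℝ E κ).hasFDerivAt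

theorem hasGradientAt_comp_smul_add {f : E → ℝ} {f' x : E} (c : ℝ) (x₀ : E)
    (hf : HasGradientAt f f' (c • x + x₀)) :
    HasGradientAt (fun y => f (c • y + x₀)) (c • f') x := by
  rw [hasGradientAt_iff_hasFDerivAt] at *
  have h1 : HasFDerivAt (fun y : E => c • y + x₀) (c • ContinuousLinearMap.id ℝ E) x :=
    ((hasFDerivAt_id x).const_smul c).add_const x₀
  have h := hf.comp x h1
  refine HasFDerivAt.congr_fderiv h ?_
  ext y
  simp

theorem hasGradientAt_of_contDiff {φ : E → ℝ} (hφ : ContDiff ℝ 1 φ) (x : E) :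
    HasGradientAt φ (gradient φ x) x :=
  (hφ.differentiable (by norm_num) x).hasGradientAt

theorem continuous_gradient_of_contDiff {φ : E → ℝ} (hφ : ContDiff ℝ 1 φ) :
    Continuous (gradient φ) := by
  unfold gradient
  exact (InnerProductSpace.toDual ℝ E).symm.continuous.comp (hφ.continuous_fderiv (by norm_num))

theorem gradient_eq_zero_of_isLocalMax {φ : E → ℝ} {x : E} (h : IsLocalMax φ x) :
    gradient φ x = 0 := by
  simp [gradient, h.fderiv_eq_zero]

end Gradient

/-! ### Viscosity sub- and supersolutions. -/

section Viscosity

variable {E : Type*} [NormedAddCommGroup E] [InnerProductSpace ℝ E] [CompleteSpace E]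

/-- Viscosity subsolutions of `F (x, v, Dv) ≤ 0`. -/
def IsViscSub (F : E → ℝ → E → ℝ) (v : E → ℝ) : Prop :=
  ∀ φ : E → ℝ, ContDiff ℝ 1 φ → ∀ x, IsLocalMax (fun y => v y - φ y) x →
    F x (v x) (gradient φ x) ≤ 0

/-- Viscosity supersolutions of `F (x, v, Dv) ≥ 0`. -/
def IsViscSuper (F : E → ℝ → E → ℝ) (v : E → ℝ) : Prop :=
  ∀ φ : E → ℝ, ContDiff ℝ 1 φ → ∀ x, IsLocalMin (fun y => v y - φ y) x →
    0 ≤ F x (v x) (gradient φ x)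

/-- Negation turns touching from below into touching from above, so stability and rescaling need to
be proved for subsolutions only. -/
theorem isViscSuper_of_isViscSub_neg {F : E → ℝ → E → ℝ} {v : E → ℝ}
    (h : IsViscSub (fun x r q => -F x (-r) (-q)) (fun x => -v x)) : IsViscSuper F v := by
  intro φ hφ x hx
  have h1 := h (fun y => - φ y) hφ.neg x (by
    have := hx.neg
    refine this.congr (Eventually.of_forall fun y => ?_)
    simp [sub_eq_add_neg, add_comm])
  rw [(hasGradientAt_neg (hasGradientAt_of_contDiff hφ x)).gradient] at h1
  simpa using h1

theorem IsViscSuper.isViscSub_neg {F : E → ℝ → E → ℝ} {v : E → ℝ}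
    (h : IsViscSuper F v) : IsViscSub (fun x r q => -F x (-r) (-q)) (fun x => -v x) := by
  intro φ hφ x hx
  have h1 := h (fun y => - φ y) hφ.neg x (by
    have := hx.neg
    refine this.congr (Eventually.of_forall fun y => ?_)
    simp [sub_eq_add_neg, add_comm])
  rw [(hasGradientAt_neg (hasGradientAt_of_contDiff hφ x)).gradient] at h1
  simpa using h1

end Viscosity

/-! ### Periodic functions and the comparison principle. -/

section Periodic

variable {n : ℕ}

/-- Functions on `ℝⁿ` that are `N ℤⁿ`-periodic. -/
def IsPeriodicWith (N : ℕ) (f : EuclideanSpace ℝ (Fin n) → ℝ) : Prop :=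
  ∀ (z : Fin n → ℤ) (x : EuclideanSpace ℝ (Fin n)), f (x + (N : ℝ) • intVec z) = f x

theorem natCast_smul_intVec (N : ℕ) (z : Fin n → ℤ) :
    (N : ℝ) • intVec z = intVec (fun i => N * z i) := by
  ext i
  simp [intVec]

theorem IsZPeriodic.isPeriodicWith {f : EuclideanSpace ℝ (Fin n) → ℝ} (hf : IsZPeriodic f)
    (N : ℕ) : IsPeriodicWith N f := by
  intro z x
  rw [natCast_smul_intVec, hf]

/-- A compact set which meets every orbit of `N ℤⁿ`. -/
theorem exists_isCompact_forall_exists_intVec (n : ℕ) {N : ℕ} (hN : 0 < N) :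
    ∃ K : Set (EuclideanSpace ℝ (Fin n)), IsCompact K ∧ 0 ∈ K ∧
      ∀ x, ∃ z : Fin n → ℤ, x + (N : ℝ) • intVec z ∈ K := by
  have hN' : (0 : ℝ) < N := by exact_mod_cast hN
  refine ⟨Metric.closedBall 0 (Real.sqrt (∑ _i : Fin n, (N : ℝ) ^ 2)),
    isCompact_closedBall _ _, Metric.mem_closedBall_self (Real.sqrt_nonneg _), fun x => ⟨fun i => -⌊x i / N⌋, ?_⟩⟩
  rw [mem_closedBall_zero_iff, EuclideanSpace.norm_eq]
  refine Real.sqrt_le_sqrt (Finset.sum_le_sum fun i _ => ?_)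
  have h1 := Int.floor_le (x i / N)
  have h2 := (Int.lt_floor_add_one (x i / N)).le
  rw [le_div_iff₀ hN'] at h1
  rw [div_le_iff₀ hN'] at h2
  simp only [PiLp.add_apply, PiLp.smul_apply, intVec, Real.norm_eq_abs, sq_abs, smul_eq_mul]
  push_cast
  exact pow_le_pow_left₀ (by linarith) (by linarith) 2

theorem IsPeriodicWith.exists_forall_le {f : EuclideanSpace ℝ (Fin n) → ℝ} {N : ℕ}
    (hf : IsPeriodicWith N f) (hN : 0 < N) (hc : Continuous f) : ∃ x, ∀ y, f y ≤ f x := by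
  obtain ⟨K, hK, h0, h⟩ := exists_isCompact_forall_exists_intVec n hN
  obtain ⟨x, -, hx⟩ := hK.exists_isMaxOn ⟨0, h0⟩ hc.continuousOn
  refine ⟨x, fun y => ?_⟩
  obtain ⟨z, hz⟩ := h y
  rw [← hf z y]
  exact hx hz

theorem IsPeriodicWith.sub {f g : EuclideanSpace ℝ (Fin n) → ℝ} {N : ℕ}
    (hf : IsPeriodicWith N f) (hg : IsPeriodicWith N g) :
    IsPeriodicWith N (fun x => f x - g x) := by
  intro z x
  simp only [hf z x, hg z x]

theorem IsPeriodicWith.neg {f : EuclideanSpace ℝ (Fin n) → ℝ} {N : ℕ}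
    (hf : IsPeriodicWith N f) : IsPeriodicWith N (fun x => - f x) := by
  intro z x
  simp only [hf z x]

theorem IsPeriodicWith.exists_abs_le {f : EuclideanSpace ℝ (Fin n) → ℝ} {N : ℕ}
    (hf : IsPeriodicWith N f) (hN : 0 < N) (hc : Continuous f) : ∃ M, 0 < M ∧ ∀ y, |f y| ≤ M := by
  obtain ⟨x, hx⟩ := hf.exists_forall_le hN hc
  obtain ⟨x', hx'⟩ := hf.neg.exists_forall_le hN hc.neg
  refine ⟨|f x| + |f x'| + 1, by positivity, fun y => abs_le.2 ⟨?_, ?_⟩⟩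
  · have := hx' y
    linarith [neg_abs_le (f x'), abs_nonneg (f x), neg_le_abs (f x'), le_abs_self (f x')]
  · linarith [hx y, le_abs_self (f x), abs_nonneg (f x')]

/-- The constant of a viscosity supersolution is at most the largest value of the Hamiltonian along
any smooth periodic function. -/
theorem IsViscSuper.le_of_contDiff {G : EuclideanSpace ℝ (Fin n) → EuclideanSpace ℝ (Fin n) → ℝ}
    {v w : EuclideanSpace ℝ (Fin n) → ℝ} {b c : ℝ} {N : ℕ} (hN : 0 < N)
    (hv : IsViscSuper (fun x _ q => G x q - c) v) (hvc : Continuous v) (hvp : IsPeriodicWith N v)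
    (hw : ContDiff ℝ 1 w) (hwp : IsPeriodicWith N w) (h : ∀ x, G x (gradient w x) ≤ b) :
    c ≤ b := by
  obtain ⟨x, hx⟩ := (hwp.sub hvp).exists_forall_le hN (hw.continuous.sub hvc)
  have := hv w hw x (Eventually.of_forall fun y => by have := hx y; dsimp only at *; linarith)
  linarith [h x]

theorem IsViscSub.le_of_contDiff {G : EuclideanSpace ℝ (Fin n) → EuclideanSpace ℝ (Fin n) → ℝ}
    {v w : EuclideanSpace ℝ (Fin n) → ℝ} {b c : ℝ} {N : ℕ} (hN : 0 < N)
    (hv : IsViscSub (fun x _ q => G x q - c) v) (hvc : Continuous v) (hvp : IsPeriodicWith N v)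
    (hw : ContDiff ℝ 1 w) (hwp : IsPeriodicWith N w) (h : ∀ x, b ≤ G x (gradient w x)) :
    b ≤ c := by
  obtain ⟨x, hx⟩ := (hvp.sub hwp).exists_forall_le hN (hvc.sub hw.continuous)
  have := hv w hw x (Eventually.of_forall fun y => hx y)
  linarith [h x]

/-- Doubling of variables: the constant of a periodic subsolution is at least that of a periodic
supersolution. -/
theorem IsViscSub.le_of_isViscSuper {H V : EuclideanSpace ℝ (Fin n) → ℝ}
    {u v : EuclideanSpace ℝ (Fin n) → ℝ} {c₁ c₂ : ℝ} {N : ℕ} (hN : 0 < N)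
    (hV : UniformContinuous V)
    (hu : IsViscSub (fun x _ q => H q + V x - c₁) u) (huc : Continuous u)
    (hup : IsPeriodicWith N u)
    (hv : IsViscSuper (fun x _ q => H q + V x - c₂) v) (hvc : Continuous v)
    (hvp : IsPeriodicWith N v) : c₂ ≤ c₁ := by
  refine le_of_forall_pos_le_add fun ε hε => ?_
  obtain ⟨δ, hδ, hVδ⟩ := Metric.uniformContinuous_iff.1 hV ε hε
  obtain ⟨M₁, hM₁, hu1⟩ := hup.exists_abs_le hN huc
  obtain ⟨M₂, hM₂, hv1⟩ := hvp.exists_abs_le hN hvc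
  obtain ⟨K, hK, hK0, hKz⟩ := exists_isCompact_forall_exists_intVec n hN
  -- the penalization is strong enough to force the two points within `δ`
  set A : ℝ := (4 * (M₁ + M₂)) / δ ^ 2 with hA
  have hApos : 0 < A := by positivity
  -- The second variable is the displacement between the two points. Lattice shifts then act on the
  -- first variable only, and a maximum over a compact set is global.
  set Φ : EuclideanSpace ℝ (Fin n) × EuclideanSpace ℝ (Fin n) → ℝ :=
    fun z => u z.1 - v (z.1 + z.2) - A * ‖z.2‖ ^ 2 with hΦ
  have hΦc : Continuous Φ := by fun_prop
  obtain ⟨⟨x, d⟩, hmem, hmax⟩ := (hK.prod (isCompact_closedBall (0 : EuclideanSpace ℝ (Fin n)) δ)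
    ).exists_isMaxOn ⟨(0, 0), hK0, by simp [hδ.le]⟩ hΦc.continuousOn
  have hglob : ∀ y e, Φ (y, e) ≤ Φ (x, d) := by
    intro y e
    obtain ⟨z, hz⟩ := hKz y
    have hshift : ∀ e, Φ (y + (N : ℝ) • intVec z, e) = Φ (y, e) := by
      intro e
      simp only [hΦ, hup z y, add_right_comm y _ e, hvp z (y + e)]
    rw [← hshift e]
    by_cases he : ‖e‖ ≤ δ
    · exact hmax (Set.mk_mem_prod hz (by simpa using he))
    · have h0 : Φ (y + (N : ℝ) • intVec z, 0) ≤ Φ (x, d) :=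
        hmax (Set.mk_mem_prod hz (by simp [hδ.le]))
      refine le_trans ?_ h0
      have h1 : A * δ ^ 2 = 4 * (M₁ + M₂) := by rw [hA]; field_simp
      have h2 : A * δ ^ 2 ≤ A * ‖e‖ ^ 2 :=
        mul_le_mul_of_nonneg_left (pow_le_pow_left₀ hδ.le (not_le.1 he).le 2) hApos.le
      simp only [hΦ, norm_zero]
      have h3 := abs_le.1 (hv1 (y + (N : ℝ) • intVec z + 0))
      have h4 := abs_le.1 (hv1 (y + (N : ℝ) • intVec z + e))
      nlinarith
  -- Comparison with zero displacement bounds the penalty by the oscillation of `v`, which is below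
  -- `A * δ ^ 2`.
  have hd : ‖d‖ < δ := by
    have h1 := hglob x 0
    simp only [hΦ, norm_zero] at h1
    have h3 := abs_le.1 (hv1 (x + 0))
    have h4 := abs_le.1 (hv1 (x + d))
    have h5 : A * δ ^ 2 = 4 * (M₁ + M₂) := by rw [hA]; field_simp
    have h6 : A * ‖d‖ ^ 2 < A * δ ^ 2 := by nlinarith
    exact lt_of_pow_lt_pow_left₀ 2 hδ.le (lt_of_mul_lt_mul_left h6 hApos.le)
  have hg1 : ∀ y, HasGradientAt (fun y => A * ‖y - (x + d)‖ ^ 2)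
      (A • (2 : ℝ) • (y - (x + d))) y := fun y =>
    hasGradientAt_const_mul A (hasGradientAt_norm_sub_sq _ _)
  have hg2 : ∀ y, HasGradientAt (fun y => - (A * ‖y - x‖ ^ 2)) (-(A • (2 : ℝ) • (y - x))) y :=
    fun y => hasGradientAt_neg (hasGradientAt_const_mul A (hasGradientAt_norm_sub_sq _ _))
  have hs1 : ∀ a : EuclideanSpace ℝ (Fin n), ContDiff ℝ 1 (fun y => A * ‖y - a‖ ^ 2) :=
    fun a => contDiff_const.mul ((contDiff_id.sub contDiff_const).norm_sq ℝ)
  -- Freezing one of the two points gives a test function for each of `u` and `v`. Both have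
  -- gradient `-2 A d`, so the `H` terms cancel and only `V (x + d) - V x < ε` remains.
  have e1 := hu _ (hs1 (x + d)) x (Eventually.of_forall fun y => by
    have := hglob y (x + d - y)
    simp only [hΦ] at this
    rw [add_sub_cancel, norm_sub_rev (x + d) y] at this
    simp only [sub_add_cancel_left, norm_neg]
    linarith)
  have e2 := hv _ (hs1 x).neg (x + d) (Eventually.of_forall fun y => by
    have := hglob x (y - x)
    simp only [hΦ] at this
    rw [add_sub_cancel] at this
    simp only [add_sub_cancel_left]
    linarith)
  rw [(hg1 x).gradient, sub_add_cancel_left] at e1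
  rw [(hg2 (x + d)).gradient, add_sub_cancel_left] at e2
  rw [smul_neg, smul_neg] at e1
  have h3 := hVδ (a := x + d) (b := x) (by rw [dist_eq_norm, add_sub_cancel_left]; exact hd)
  rw [Real.dist_eq] at h3
  linarith [(abs_lt.1 h3).2]

end Periodic

/-! ### Lipschitz bounds, stability and Perron's method. -/

section Perron

variable {E : Type*} [NormedAddCommGroup E] [InnerProductSpace ℝ E] [FiniteDimensional ℝ E]

theorem hasGradientAt_sqrt_add_norm_sub_sq {η : ℝ} (hη : 0 < η) (x₀ x : E) :
    HasGradientAt (fun y => Real.sqrt (η ^ 2 + ‖y - x₀‖ ^ 2))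
      ((1 / Real.sqrt (η ^ 2 + ‖x - x₀‖ ^ 2)) • (x - x₀)) x := by
  have hpos : 0 < η ^ 2 + ‖x - x₀‖ ^ 2 := by positivity
  have h1 : HasGradientAt (fun y => η ^ 2 + ‖y - x₀‖ ^ 2) ((2 : ℝ) • (x - x₀)) x := by
    simpa using hasGradientAt_add (hasGradientAt_const x (η ^ 2)) (hasGradientAt_norm_sub_sq x₀ x)
  have h2 := hasGradientAt_comp (f := fun y => η ^ 2 + ‖y - x₀‖ ^ 2)
    (Real.hasDerivAt_sqrt hpos.ne') h1
  convert h2 using 1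
  rw [smul_smul]
  congr 1
  field_simp

/-- A bounded continuous function whose gradient is bounded in the viscosity sense is Lipschitz. -/
theorem sub_le_of_forall_norm_gradient_le {w : E → ℝ} {M C : ℝ} (hw : Continuous w)
    (hM : ∀ x, |w x| ≤ M) (hC : 0 ≤ C)
    (h : ∀ φ : E → ℝ, ContDiff ℝ 1 φ → ∀ x, IsLocalMax (fun y => w y - φ y) x →
      ‖gradient φ x‖ ≤ C) (x y : E) : w y - w x ≤ (C + 1) * ‖y - x‖ := by
  have hM0 : 0 ≤ M := (abs_nonneg _).trans (hM x)
  refine le_of_forall_pos_le_add fun ε hε => ?_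
  obtain ⟨d, hd, hwd⟩ := Metric.continuousAt_iff.1 (hw.continuousAt (x := x)) (ε / 2) (by positivity)
  -- The first bound puts the touching point within the modulus of continuity of `w` at `x`; the
  -- second makes the error from smoothing the cone at most `ε / 2`.
  obtain ⟨η, hη, hη1, hη2⟩ : ∃ η : ℝ, 0 < η ∧ C * η < d ∧ (C + 1) * η ≤ ε / 2 := by
    refine ⟨min (d / (C + 1)) (ε / 2 / (C + 1)), by positivity, ?_, ?_⟩
    · calc C * min (d / (C + 1)) (ε / 2 / (C + 1)) < (C + 1) * min (d / (C + 1)) (ε / 2 / (C + 1)) := by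
            gcongr; linarith
        _ ≤ (C + 1) * (d / (C + 1)) := by gcongr; exact min_le_left _ _
        _ = d := by field_simp
    · calc (C + 1) * min (d / (C + 1)) (ε / 2 / (C + 1)) ≤ (C + 1) * (ε / 2 / (C + 1)) := by
            gcongr; exact min_le_right _ _
        _ = ε / 2 := by field_simp
  -- A smoothed cone of slope `C + 1`. Away from its vertex the slope exceeds `C`, so it can touch
  -- `w` from above only near `x`.
  set φ : E → ℝ := fun y => (C + 1) * Real.sqrt (η ^ 2 + ‖y - x‖ ^ 2) with hφ
  have hφs : ContDiff ℝ 1 φ := by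
    refine contDiff_const.mul (ContDiff.sqrt ?_ fun y => by positivity)
    exact contDiff_const.add ((contDiff_id.sub contDiff_const).norm_sq ℝ)
  have hφ0 : φ x = (C + 1) * η := by simp [hφ, Real.sqrt_sq hη.le]
  have hφge : ∀ y, (C + 1) * ‖y - x‖ ≤ φ y := fun y => by
    refine mul_le_mul_of_nonneg_left (Real.le_sqrt_of_sq_le ?_) (by positivity)
    nlinarith [sq_nonneg η]
  have hφle : ∀ y, φ y ≤ (C + 1) * ‖y - x‖ + (C + 1) * η := fun y => by
    rw [← mul_add]
    refine mul_le_mul_of_nonneg_left (Real.sqrt_le_left (by positivity) |>.2 ?_) (by positivity)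
    nlinarith [mul_nonneg hη.le (norm_nonneg (y - x))]
  have hφge' : ∀ y, (C + 1) * η ≤ φ y := fun y => by
    refine mul_le_mul_of_nonneg_left (Real.le_sqrt_of_sq_le ?_) (by positivity)
    nlinarith [sq_nonneg ‖y - x‖]
  obtain ⟨m, hm⟩ := (hw.sub hφs.continuous).exists_forall_ge' x (by
    filter_upwards [(isCompact_closedBall x (2 * M + (C + 1) * η)).compl_mem_cocompact] with z hz
    rw [Set.mem_compl_iff, mem_closedBall_iff_norm, not_le] at hz
    have h1 := abs_le.1 (hM z)
    have h2 := abs_le.1 (hM x)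
    have h3 : ‖z - x‖ ≤ (C + 1) * ‖z - x‖ := by nlinarith [norm_nonneg (z - x)]
    rw [Pi.sub_apply, Pi.sub_apply, hφ0]
    linarith [hφge z])
  have hgrad := h φ hφs m (Eventually.of_forall fun y => hm y)
  have hspos : 0 < Real.sqrt (η ^ 2 + ‖m - x‖ ^ 2) := Real.sqrt_pos.2 (by positivity)
  rw [(hasGradientAt_const_mul (C + 1) (hasGradientAt_sqrt_add_norm_sub_sq hη x m)).gradient,
    norm_smul, norm_smul, Real.norm_eq_abs, Real.norm_eq_abs, abs_of_pos (by positivity : 0 < C + 1),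
    abs_of_pos (by positivity), one_div, inv_mul_eq_div, ← mul_div_assoc, div_le_iff₀ hspos] at hgrad
  have hmx : ‖m - x‖ ≤ C * η := by
    have h1 : ((C + 1) * ‖m - x‖) ^ 2 ≤ (C * Real.sqrt (η ^ 2 + ‖m - x‖ ^ 2)) ^ 2 :=
      pow_le_pow_left₀ (by positivity) hgrad 2
    rw [mul_pow, mul_pow, Real.sq_sqrt (by positivity)] at h1
    refine le_of_sq_le_sq ?_ (by positivity)
    nlinarith [mul_nonneg hC (sq_nonneg ‖m - x‖)]
  have h1 := hwd (x := m) (by rw [dist_eq_norm]; linarith)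
  rw [Real.dist_eq] at h1
  have h2 := hm y
  rw [Pi.sub_apply, Pi.sub_apply] at h2
  linarith [(abs_lt.1 h1).2, hφle y, hφge' m]

/-- Stability of viscosity subsolutions under one-sided approximation. -/
theorem isViscSub_of_forall_exists {F : E → ℝ → E → ℝ}
    (hF : Continuous fun z : E × ℝ × E => F z.1 z.2.1 z.2.2) {v : E → ℝ} (hv : Continuous v)
    (h : ∀ x₀, ∀ ε > 0, ∃ w : E → ℝ, Continuous w ∧ IsViscSub (fun x r q => F x r q - ε) w ∧
      (∀ x ∈ Metric.closedBall x₀ 1, w x ≤ v x + ε) ∧ v x₀ - ε ≤ w x₀) : IsViscSub F v := by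
  intro φ hφ x₀ hx₀
  obtain ⟨r, hr, hr1, hball⟩ : ∃ r : ℝ, 0 < r ∧ r ≤ 1 ∧ ∀ y ∈ Metric.closedBall x₀ r,
      v y - φ y ≤ v x₀ - φ x₀ := by
    obtain ⟨r, hr, hball⟩ := Metric.nhds_basis_closedBall.mem_iff.1 hx₀
    exact ⟨min r 1, by positivity, min_le_right _ _, fun y hy =>
      hball (Metric.closedBall_subset_closedBall (min_le_left _ _) hy)⟩
  set ε : ℕ → ℝ := fun k => 1 / ((k : ℝ) + 1) with hε
  have hεpos : ∀ k, 0 < ε k := fun k => by positivity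
  have hε0 : Tendsto ε atTop (𝓝 0) := tendsto_one_div_add_atTop_nhds_zero_nat
  choose w hwc hws hwle hwge using fun k => h x₀ (ε k) (hεpos k)
  -- The quadratic term makes the maximum at `x₀` strict, which forces the maximum points of the
  -- approximants to converge to `x₀`.
  set ψ : E → ℝ := fun y => φ y + ‖y - x₀‖ ^ 2 with hψ
  have hψs : ContDiff ℝ 1 ψ := hφ.add ((contDiff_id.sub contDiff_const).norm_sq ℝ)
  have hψg : ∀ y, gradient ψ y = gradient φ y + (2 : ℝ) • (y - x₀) := fun y =>
    (hasGradientAt_add (hasGradientAt_of_contDiff hφ y) (hasGradientAt_norm_sub_sq x₀ y)).gradient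
  have hmax : ∀ k, ∃ y ∈ Metric.closedBall x₀ r, ∀ z ∈ Metric.closedBall x₀ r,
      w k z - ψ z ≤ w k y - ψ y := fun k =>
    (isCompact_closedBall x₀ r).exists_isMaxOn ⟨x₀, Metric.mem_closedBall_self hr.le⟩
      ((hwc k).sub hψs.continuous).continuousOn
  choose y hyB hymax using hmax
  have hsq : ∀ k, ‖y k - x₀‖ ^ 2 ≤ 2 * ε k := fun k => by
    have h1 := hymax k x₀ (Metric.mem_closedBall_self hr.le)
    have h2 := hwle k (y k) (Metric.closedBall_subset_closedBall hr1 (hyB k))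
    have h3 := hball (y k) (hyB k)
    have h4 := hwge k
    simp only [hψ, sub_self, norm_zero] at h1
    linarith
  have hy0 : Tendsto y atTop (𝓝 x₀) := by
    rw [tendsto_iff_norm_sub_tendsto_zero]
    have h1 : Tendsto (fun k => ‖y k - x₀‖ ^ 2) atTop (𝓝 0) :=
      squeeze_zero (fun k => by positivity) hsq (by simpa using hε0.const_mul 2)
    have h2 := (Real.continuous_sqrt.tendsto 0).comp h1
    simpa [Function.comp_def, Real.sqrt_sq (norm_nonneg _)] using h2
  have hwy : Tendsto (fun k => w k (y k)) atTop (𝓝 (v x₀)) := by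
    have hup : Tendsto (fun k => v (y k) + ε k) atTop (𝓝 (v x₀)) := by
      simpa using ((hv.tendsto x₀).comp hy0).add hε0
    have hlo : Tendsto (fun k => v x₀ - ε k + (φ (y k) - φ x₀)) atTop (𝓝 (v x₀)) := by
      simpa using (hε0.const_sub (v x₀)).add
        (((hφ.continuous.tendsto x₀).comp hy0).sub_const (φ x₀))
    refine tendsto_of_tendsto_of_tendsto_of_le_of_le hlo hup (fun k => ?_) (fun k => ?_)
    · have h1 := hymax k x₀ (Metric.mem_closedBall_self hr.le)
      have h4 := hwge k
      simp only [hψ, sub_self, norm_zero] at h1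
      dsimp only
      nlinarith [sq_nonneg ‖y k - x₀‖]
    · exact hwle k (y k) (Metric.closedBall_subset_closedBall hr1 (hyB k))
  have hgy : Tendsto (fun k => gradient ψ (y k)) atTop (𝓝 (gradient φ x₀)) := by
    have := ((continuous_gradient_of_contDiff hψs).tendsto x₀).comp hy0
    rwa [hψg x₀, sub_self, smul_zero, add_zero] at this
  have hlim := (hF.tendsto (x₀, v x₀, gradient φ x₀)).comp
    (hy0.prodMk_nhds (hwy.prodMk_nhds hgy))
  refine le_of_tendsto_of_tendsto hlim hε0 ?_
  have hev : ∀ᶠ k in atTop, y k ∈ Metric.ball x₀ r :=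
    hy0.eventually (Metric.ball_mem_nhds x₀ hr)
  filter_upwards [hev] with k hk
  have := hws k ψ hψs (y k) (by
    filter_upwards [Metric.isOpen_ball.mem_nhds hk] with z hz
    exact hymax k z (Metric.ball_subset_closedBall hz))
  simp only [Function.comp_def]
  linarith

theorem IsViscSub.comp_add_right {F : E → ℝ → E → ℝ} {v : E → ℝ} (hv : IsViscSub F v) (z : E)
    (hz : ∀ x r q, F (x + z) r q = F x r q) : IsViscSub F (fun x => v (x + z)) := by
  intro φ hφ x hx
  have hφ' : ContDiff ℝ 1 (fun y => φ (y - z)) := hφ.comp (contDiff_id.sub contDiff_const)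
  have hg : gradient (fun y => φ (y - z)) (x + z) = gradient φ x := by
    have := hasGradientAt_comp_smul_add (f := φ) (f' := gradient φ x) (x := x + z) 1 (-z)
      (by simpa using hasGradientAt_of_contDiff hφ x)
    simpa [sub_eq_add_neg] using this.gradient
  have h := hv _ hφ' (x + z) (by
    have hc : Tendsto (fun y => y - z) (𝓝 (x + z)) (𝓝 x) := by
      have : Continuous fun y : E => y - z := by fun_prop
      simpa using this.tendsto (x + z)
    filter_upwards [hc.eventually hx] with y hy
    simpa using hy)
  rwa [hg, hz] at h

/-- Perron's method, between two constant barriers. -/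
theorem exists_isViscSub_isViscSuper {F : E → ℝ → E → ℝ}
    (hF : Continuous fun z : E × ℝ × E => F z.1 z.2.1 z.2.2) {a b C : ℝ} (hab : a ≤ b)
    (hC : 0 ≤ C) (ha : ∀ x, F x a 0 ≤ 0) (hb : ∀ x, 0 ≤ F x b 0)
    (hcoer : ∀ x r q, a ≤ r → F x r q ≤ 0 → ‖q‖ ≤ C) :
    ∃ v : E → ℝ, Continuous v ∧ (∀ x y, v y - v x ≤ (C + 1) * ‖y - x‖) ∧
      (∀ x, a ≤ v x ∧ v x ≤ b) ∧ IsViscSub F v ∧ IsViscSuper F v ∧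
      ∀ z, (∀ x r q, F (x + z) r q = F x r q) → ∀ x, v (x + z) = v x := by
  set 𝒮 : Set (E → ℝ) := {w | Continuous w ∧ (∀ x, a ≤ w x ∧ w x ≤ b) ∧ IsViscSub F w} with h𝒮
  have hmem_a : (fun _ => a) ∈ 𝒮 := by
    refine ⟨continuous_const, fun x => ⟨le_rfl, hab⟩, fun φ hφ x hx => ?_⟩
    have h1 : gradient φ x = 0 := by
      have h2 : IsLocalMax (fun y => - φ y) x := by
        filter_upwards [hx] with y hy
        linarith
      have h3 := gradient_eq_zero_of_isLocalMax h2
      rwa [(hasGradientAt_neg (hasGradientAt_of_contDiff hφ x)).gradient, neg_eq_zero] at h3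
    rw [h1]
    exact ha x
  -- Coercivity makes the whole class equi-Lipschitz. The supremum is thus continuous and no
  -- semicontinuous envelopes are needed.
  have hlip : ∀ w ∈ 𝒮, ∀ x y, w y - w x ≤ (C + 1) * ‖y - x‖ := by
    rintro w ⟨hwc, hwb, hws⟩ x y
    refine sub_le_of_forall_norm_gradient_le (M := |a| + |b|) hwc (fun x => ?_) hC
      (fun φ hφ x hx => hcoer x (w x) _ (hwb x).1 (hws φ hφ x hx)) x y
    have := hwb x
    exact abs_le.2 ⟨by linarith [neg_abs_le a, abs_nonneg b], by
      linarith [le_abs_self b, abs_nonneg a]⟩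
  have : Nonempty 𝒮 := ⟨⟨_, hmem_a⟩⟩
  set u : E → ℝ := fun x => ⨆ w : 𝒮, (w : E → ℝ) x with hu
  have hbdd : ∀ x, BddAbove (Set.range fun w : 𝒮 => (w : E → ℝ) x) := fun x =>
    ⟨b, by rintro _ ⟨w, rfl⟩; exact (w.2.2.1 x).2⟩
  have hle : ∀ w ∈ 𝒮, ∀ x, w x ≤ u x := fun w hw x => le_ciSup (hbdd x) ⟨w, hw⟩
  have hulip : ∀ x y, u y - u x ≤ (C + 1) * ‖y - x‖ := fun x y => by
    rw [sub_le_iff_le_add]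
    refine ciSup_le fun w => ?_
    linarith [hlip w w.2 x y, hle w w.2 x]
  have huc : Continuous u := by
    refine (LipschitzWith.of_dist_le_mul (K := Real.toNNReal (C + 1)) fun x y => ?_).continuous
    rw [Real.dist_eq, dist_eq_norm, Real.coe_toNNReal _ (by linarith)]
    refine abs_le.2 ⟨?_, hulip y x⟩
    have := hulip x y
    rw [norm_sub_rev] at this
    linarith
  have hua : ∀ x, a ≤ u x := fun x => hle _ hmem_a x
  have hub : ∀ x, u x ≤ b := fun x => ciSup_le fun w => (w.2.2.1 x).2
  have husub : IsViscSub F u := by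
    -- One member of the class that nearly attains the supremum at `x₀` suffices: stability requires
    -- closeness from below only at the centre.
    refine isViscSub_of_forall_exists hF huc fun x₀ ε hε => ?_
    obtain ⟨w, hw⟩ := exists_lt_of_lt_ciSup (show u x₀ - ε < u x₀ by linarith)
    refine ⟨w, w.2.1, fun φ hφ x hx => ?_, fun x _ => ?_, hw.le⟩
    · linarith [w.2.2.2 φ hφ x hx]
    · linarith [hle w w.2 x]
  refine ⟨u, huc, hulip, fun x => ⟨hua x, hub x⟩, husub, ?_, ?_⟩
  · intro φ hφ x₀ hx₀
    by_contra! hneg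
    rcases (hub x₀).eq_or_lt with hx₀b | hx₀b
    · have h1 : IsLocalMax φ x₀ := by
        filter_upwards [hx₀] with y hy
        linarith [hub y]
      rw [gradient_eq_zero_of_isLocalMax h1, hx₀b] at hneg
      exact absurd (hb x₀) (not_le.2 hneg)
    -- Bump construction: if the supersolution property fails at `x₀`, a slightly raised test
    -- function glued to `u` is a larger member of the class.
    set ψ : E → ℝ := fun y => φ y - ‖y - x₀‖ ^ 2 + (u x₀ - φ x₀) with hψ
    have hψs : ContDiff ℝ 1 ψ :=
      (hφ.sub ((contDiff_id.sub contDiff_const).norm_sq ℝ)).add contDiff_const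
    have hψx₀ : ψ x₀ = u x₀ := by simp [hψ]
    have hψg : gradient ψ x₀ = gradient φ x₀ := by
      have := hasGradientAt_add (hasGradientAt_sub (hasGradientAt_of_contDiff hφ x₀)
        (hasGradientAt_norm_sub_sq x₀ x₀)) (hasGradientAt_const x₀ (u x₀ - φ x₀))
      simpa using this.gradient
    -- a neighbourhood on which the perturbed test function is a strict subsolution
    have hcont1 : Continuous fun z : E × ℝ => F z.1 (ψ z.1 + z.2) (gradient ψ z.1) :=
      hF.comp (continuous_fst.prodMk (((hψs.continuous.comp continuous_fst).add
        continuous_snd).prodMk ((continuous_gradient_of_contDiff hψs).comp continuous_fst)))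
    have hcont2 : Continuous fun z : E × ℝ => ψ z.1 + z.2 :=
      (hψs.continuous.comp continuous_fst).add continuous_snd
    have hev : ∀ᶠ z in 𝓝 (x₀, (0 : ℝ)),
        F z.1 (ψ z.1 + z.2) (gradient ψ z.1) < 0 ∧ ψ z.1 + z.2 < b := by
      refine ((hcont1.tendsto _).eventually (gt_mem_nhds ?_)).and
        ((hcont2.tendsto _).eventually (gt_mem_nhds ?_))
      · simpa [hψx₀, hψg] using hneg
      · simpa [hψx₀] using hx₀b
    obtain ⟨r₁, hr₁, hball₁⟩ := Metric.nhds_basis_ball.mem_iff.1 hev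
    obtain ⟨r₂, hr₂, hball₂⟩ := Metric.nhds_basis_ball.mem_iff.1 hx₀
    set r := min r₁ r₂ with hr
    have hrpos : 0 < r := by positivity
    -- With `η < r ^ 2` the raised function lies below `u` near the boundary of the ball, so the
    -- gluing is continuous.
    obtain ⟨η, hη, hηr, hηr₁⟩ : ∃ η : ℝ, 0 < η ∧ η < r ^ 2 ∧ η < r₁ :=
      ⟨min (r ^ 2) r₁ / 2, by positivity, by
        linarith [min_le_left (r ^ 2) r₁, (by positivity : 0 < min (r ^ 2) r₁)], by
        linarith [min_le_right (r ^ 2) r₁, (by positivity : 0 < min (r ^ 2) r₁)]⟩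
    have hstrict : ∀ y, ‖y - x₀‖ < r →
        F y (ψ y + η) (gradient ψ y) < 0 ∧ ψ y + η < b := fun y hy => by
      refine hball₁ (show (y, η) ∈ Metric.ball (x₀, (0 : ℝ)) r₁ from ?_)
      rw [Metric.mem_ball, Prod.dist_eq, max_lt_iff]
      refine ⟨by rw [dist_eq_norm]; exact hy.trans_le (min_le_left _ _), ?_⟩
      simpa [abs_of_pos hη] using hηr₁
    have hbelow : ∀ y, ‖y - x₀‖ < r → ψ y ≤ u y - ‖y - x₀‖ ^ 2 := fun y hy => by
      have : y ∈ Metric.ball x₀ r₂ := by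
        rw [mem_ball_iff_norm]; exact hy.trans_le (min_le_right _ _)
      have := hball₂ this
      simp only [Set.mem_ofPred_eq] at this
      simp only [hψ]
      linarith
    classical
    set w : E → ℝ := fun y => if ‖y - x₀‖ < r then max (u y) (ψ y + η) else u y with hw
    have hw_in : ∀ y, ‖y - x₀‖ < r → w y = max (u y) (ψ y + η) := fun y hy => if_pos hy
    have hw_ge : ∀ y, u y ≤ w y := fun y => by
      by_cases hy : ‖y - x₀‖ < r
      · rw [hw_in y hy]; exact le_max_left _ _
      · exact (if_neg hy).ge
    have hw_out : ∀ y, η < ‖y - x₀‖ ^ 2 → w y = u y := fun y hy => by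
      by_cases hy' : ‖y - x₀‖ < r
      · rw [hw_in y hy', max_eq_left]
        linarith [hbelow y hy']
      · exact if_neg hy'
    have hnc : Continuous fun y : E => ‖y - x₀‖ := by fun_prop
    have hw𝒮 : w ∈ 𝒮 := by
      refine ⟨continuous_iff_continuousAt.2 fun y => ?_, fun y => ⟨(hua y).trans (hw_ge y), ?_⟩, ?_⟩
      · by_cases hy : ‖y - x₀‖ < r
        · refine ContinuousAt.congr (f := fun y => max (u y) (ψ y + η))
            (huc.max (hψs.continuous.add continuous_const)).continuousAt ?_
          filter_upwards [(isOpen_lt hnc continuous_const).mem_nhds hy] with z hz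
          exact (hw_in z hz).symm
        · refine ContinuousAt.congr (f := u) huc.continuousAt ?_
          have hy2 : η < ‖y - x₀‖ ^ 2 :=
            hηr.trans_le (pow_le_pow_left₀ hrpos.le (not_lt.1 hy) 2)
          filter_upwards [(isOpen_lt continuous_const (hnc.pow 2)).mem_nhds hy2] with z hz
          exact (hw_out z hz).symm
      · by_cases hy : ‖y - x₀‖ < r
        · rw [hw_in y hy]; exact max_le (hub y) (hstrict y hy).2.le
        · exact (if_neg hy : w y = u y).le.trans (hub y)
      · intro θ hθ y hy
        by_cases hwu : w y = u y
        · rw [hwu]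
          refine husub θ hθ y ?_
          filter_upwards [hy] with z hz
          linarith [hw_ge z]
        · have hyr : ‖y - x₀‖ < r := by
            by_contra hyr
            exact hwu (if_neg hyr)
          have hwy : w y = ψ y + η := by
            rw [hw_in y hyr] at hwu ⊢
            rcases max_choice (u y) (ψ y + η) with h | h
            · exact absurd h hwu
            · exact h
          -- Where the bump is active, `θ` touches the smooth function `ψ + η` from above, so the
          -- gradients coincide.
          have hg : gradient ψ y = gradient θ y := by
            have h1 : IsLocalMax (fun z => ψ z - θ z) y := by
              filter_upwards [hy, (isOpen_lt hnc continuous_const).mem_nhds hyr] with z hz hzr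
              have : ψ z + η ≤ w z := by rw [hw_in z hzr]; exact le_max_right _ _
              linarith
            have h2 := gradient_eq_zero_of_isLocalMax h1
            rw [(hasGradientAt_sub (hasGradientAt_of_contDiff hψs y)
              (hasGradientAt_of_contDiff hθ y)).gradient] at h2
            exact sub_eq_zero.1 h2
          rw [hwy, ← hg]
          exact (hstrict y hyr).1.le
    have h1 := hle w hw𝒮 x₀
    have h2 := hw_in x₀ (by simpa using hrpos)
    rw [h2, hψx₀] at h1
    linarith [le_max_right (u x₀) (u x₀ + η)]
  -- The class is invariant under translations that preserve `F`, hence so is its supremum.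
  · have key : ∀ z, (∀ x r q, F (x + z) r q = F x r q) → ∀ x, u (x + z) ≤ u x := by
      intro z hz x
      refine ciSup_le fun w => ?_
      exact hle (fun y => (w : E → ℝ) (y + z)) ⟨w.2.1.comp (by fun_prop), fun y => w.2.2.1 _,
        w.2.2.2.comp_add_right z hz⟩ x
    intro z hz x
    refine le_antisymm (key z hz x) ?_
    have := key (-z) (fun y r q => by rw [← hz, neg_add_cancel_right]) (x + z)
    rwa [add_neg_cancel_right] at this

end Perron

/-! ### Solvability of the cell problem by vanishing discount. -/

section Existence

/-- Pointwise convergence of equi-Lipschitz functions is uniform on compact sets. -/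
theorem eventually_forall_abs_sub_le {ι E : Type*} [NormedAddCommGroup E] {l : Filter ι}
    {u : ι → E → ℝ} {v : E → ℝ} {K : ℝ} (hK : 0 ≤ K)
    (hu : ∀ k x y, u k y - u k x ≤ K * ‖y - x‖) (hv : ∀ x y, v y - v x ≤ K * ‖y - x‖)
    (h : ∀ x, Tendsto (fun k => u k x) l (𝓝 (v x))) {S : Set E} (hS : IsCompact S)
    {ε : ℝ} (hε : 0 < ε) : ∀ᶠ k in l, ∀ x ∈ S, |u k x - v x| ≤ ε := by
  set ρ := ε / (3 * (K + 1)) with hρ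
  have hρpos : 0 < ρ := by positivity
  have hKρ : K * ρ ≤ ε / 3 := by
    have : (K + 1) * ρ = ε / 3 := by rw [hρ]; field_simp
    nlinarith
  obtain ⟨T, -, hTf, hT⟩ := hS.finite_cover_balls hρpos
  have hev : ∀ᶠ k in l, ∀ t ∈ T, |u k t - v t| < ε / 3 :=
    (hTf.eventually_all).2 fun t _ => by
      have := Metric.tendsto_nhds.1 (h t) (ε / 3) (by positivity)
      simpa only [Real.dist_eq] using this
  filter_upwards [hev] with k hk x hx
  obtain ⟨t, ht, hxt⟩ := Set.mem_iUnion₂.1 (hT hx)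
  rw [mem_ball_iff_norm] at hxt
  have hKx : K * ‖x - t‖ ≤ ε / 3 := (mul_le_mul_of_nonneg_left hxt.le hK).trans hKρ
  have h1 := hu k t x
  have h2 := hu k x t
  have h3 := hv t x
  have h4 := hv x t
  rw [norm_sub_rev t x] at h2 h4
  have h5 := abs_lt.1 (hk t ht)
  exact abs_le.2 ⟨by linarith [h5.1], by linarith [h5.2]⟩

variable {n : ℕ}

theorem continuous_kinetic : Continuous (kinetic (n := n)) := by
  unfold kinetic
  fun_prop

theorem kinetic_nonneg (p : EuclideanSpace ℝ (Fin n)) : 0 ≤ kinetic p := by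
  unfold kinetic
  positivity

theorem isCellSolution_iff {V : EuclideanSpace ℝ (Fin n) → ℝ} {p : EuclideanSpace ℝ (Fin n)}
    {c : ℝ} {v : EuclideanSpace ℝ (Fin n) → ℝ} :
    IsCellSolution kinetic V p c v ↔ Continuous v ∧ IsZPeriodic v ∧
      IsViscSub (fun x _ q => kinetic (p + q) + V x - c) v ∧
      IsViscSuper (fun x _ q => kinetic (p + q) + V x - c) v := by
  constructor
  · rintro ⟨h1, h2, h3, h4⟩
    exact ⟨h1, h2, fun φ hφ x hx => by linarith [h3 φ hφ x hx],
      fun φ hφ x hx => by linarith [h4 φ hφ x hx]⟩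
  · rintro ⟨h1, h2, h3, h4⟩
    exact ⟨h1, h2, fun φ hφ x hx => by linarith [h3 φ hφ x hx],
      fun φ hφ x hx => by linarith [h4 φ hφ x hx]⟩

/-- The cell problem is solvable: vanishing discount. -/
theorem exists_isCellSolution {V : EuclideanSpace ℝ (Fin n) → ℝ} (hVc : Continuous V)
    (hVp : IsZPeriodic V) (p : EuclideanSpace ℝ (Fin n)) :
    ∃ c v, IsCellSolution kinetic V p c v := by
  obtain ⟨B, hB, hVB⟩ := (hVp.isPeriodicWith 1).exists_abs_le one_pos hVc
  -- With this `M` the constants `±M / δ` are barriers for the discounted equation, and the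
  -- coercivity constant `C` does not depend on the discount.
  set M := kinetic p + B with hM
  have hMpos : 0 < M := by linarith [kinetic_nonneg p]
  set C := Real.sqrt (2 * (M + B)) + ‖p‖ with hC
  have hC0 : 0 ≤ C := by positivity
  set δ : ℕ → ℝ := fun k => 1 / ((k : ℝ) + 1) with hδ
  have hδpos : ∀ k, 0 < δ k := fun k => by positivity
  have hδ0 : Tendsto δ atTop (𝓝 0) := tendsto_one_div_add_atTop_nhds_zero_nat
  have hdisc : ∀ k, ∃ v : EuclideanSpace ℝ (Fin n) → ℝ, Continuous v ∧
      (∀ x y, v y - v x ≤ (C + 1) * ‖y - x‖) ∧ (∀ x, |δ k * v x| ≤ M) ∧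
      IsViscSub (fun x r q => δ k * r + kinetic (p + q) + V x) v ∧
      IsViscSuper (fun x r q => δ k * r + kinetic (p + q) + V x) v ∧ IsZPeriodic v := by
    intro k
    have hbar : δ k * (M / δ k) = M := mul_div_cancel₀ _ (hδpos k).ne'
    obtain ⟨v, h1, h2, h3, h4, h5, h6⟩ := exists_isViscSub_isViscSuper
      (E := EuclideanSpace ℝ (Fin n))
      (F := fun x r q => δ k * r + kinetic (p + q) + V x) (a := -(M / δ k)) (b := M / δ k) (C := C)
      (by have := continuous_kinetic (n := n); fun_prop)
      (by have : 0 ≤ M / δ k := div_nonneg hMpos.le (hδpos k).le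
          linarith) hC0
      (fun x => by
        have := abs_le.1 (hVB x)
        rw [mul_neg, hbar, add_zero]
        linarith)
      (fun x => by
        have := abs_le.1 (hVB x)
        rw [hbar, add_zero]
        linarith [kinetic_nonneg p])
      (fun x r q hr hF => by
        have h1 : -M ≤ δ k * r := by
          rw [← hbar, ← mul_neg]
          exact mul_le_mul_of_nonneg_left hr (hδpos k).le
        have h2 := abs_le.1 (hVB x)
        have h3 : ‖p + q‖ ≤ Real.sqrt (2 * (M + B)) := by
          refine Real.le_sqrt_of_sq_le ?_
          unfold kinetic at hF
          linarith
        calc ‖q‖ = ‖(p + q) - p‖ := by rw [add_sub_cancel_left]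
          _ ≤ ‖p + q‖ + ‖p‖ := norm_sub_le _ _
          _ ≤ C := by rw [hC]; gcongr)
    refine ⟨v, h1, h2, fun x => ?_, h4, h5, fun z => h6 (intVec z) fun x r q => ?_⟩
    · have h7 := mul_le_mul_of_nonneg_left (h3 x).1 (hδpos k).le
      have h8 := mul_le_mul_of_nonneg_left (h3 x).2 (hδpos k).le
      rw [mul_neg, hbar] at h7
      rw [hbar] at h8
      exact abs_le.2 ⟨h7, h8⟩
    · rw [hVp z x]
  choose v hvc hvl hvb hvsub hvsup hvp using hdisc
  obtain ⟨S, hS, hS0, hSz⟩ := exists_isCompact_forall_exists_intVec n one_pos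
  obtain ⟨R, hR⟩ := hS.isBounded.exists_norm_le
  have hR0 : 0 ≤ R := by simpa using hR 0 hS0
  -- Discounted solutions may grow like `1 / δ`, but their oscillation is bounded uniformly;
  -- subtracting the value at `0` keeps them bounded.
  set u : ℕ → EuclideanSpace ℝ (Fin n) → ℝ := fun k x => v k x - v k 0 with hu
  have hul : ∀ k x y, u k y - u k x ≤ (C + 1) * ‖y - x‖ := fun k x y => by
    simpa only [hu, sub_sub_sub_cancel_right] using hvl k x y
  have hub : ∀ k x, |u k x| ≤ (C + 1) * R := by
    intro k x
    obtain ⟨z, hz⟩ := hSz x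
    rw [Nat.cast_one, one_smul] at hz
    have h1 : v k x = v k (x + intVec z) := (hvp k z x).symm
    have h2 := hvl k 0 (x + intVec z)
    have h3 := hvl k (x + intVec z) 0
    have h4 := hR _ hz
    rw [sub_zero] at h2
    rw [zero_sub, norm_neg] at h3
    have h5 : (C + 1) * ‖x + intVec z‖ ≤ (C + 1) * R := by gcongr
    simp only [hu, h1]
    exact abs_le.2 ⟨by linarith, by linarith⟩
  -- pointwise limits along an ultrafilter
  set 𝒰 : Ultrafilter ℕ := hyperfilter ℕ with h𝒰
  have hlim : ∀ (f : ℕ → ℝ) (A : ℝ), (∀ k, |f k| ≤ A) → ∃ L, Tendsto f 𝒰 (𝓝 L) := by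
    intro f A hf
    obtain ⟨L, -, hL⟩ := (isCompact_Icc (a := -A) (b := A)).ultrafilter_le_nhds (𝒰.map f) (by
      rw [le_principal_iff, Ultrafilter.coe_map]
      exact mem_map.2 (univ_mem' fun k => abs_le.1 (hf k)))
    exact ⟨L, hL⟩
  obtain ⟨c', hc'⟩ := hlim (fun k => δ k * v k 0) M fun k => hvb k 0
  choose w hw using fun x => hlim (fun k => u k x) _ fun k => hub k x
  have hδ𝒰 : Tendsto δ 𝒰 (𝓝 0) := hδ0.mono_left Nat.hyperfilter_le_atTop
  have hwl : ∀ x y, w y - w x ≤ (C + 1) * ‖y - x‖ := fun x y =>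
    le_of_tendsto' ((hw y).sub (hw x)) fun k => hul k x y
  have hwc : Continuous w := by
    refine (LipschitzWith.of_dist_le_mul (K := Real.toNNReal (C + 1)) fun x y => ?_).continuous
    rw [Real.dist_eq, dist_eq_norm, Real.coe_toNNReal _ (by linarith)]
    refine abs_le.2 ⟨?_, hwl y x⟩
    have := hwl x y
    rw [norm_sub_rev] at this
    linarith
  have hwp : IsZPeriodic w := fun z x => by
    refine tendsto_nhds_unique (hw (x + intVec z)) ?_
    simpa only [hu, hvp _ z x] using hw x
  have huc : ∀ k, Continuous (u k) := fun k => (hvc k).sub continuous_const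
  -- eventually the constant part of the discounted term is within `ε` of its limit
  have hsmall : ∀ ε > 0, ∀ᶠ k in (𝒰 : Filter ℕ), ∀ x, |δ k * v k x - c'| ≤ ε := by
    intro ε hε
    have h1 : ∀ᶠ k in (𝒰 : Filter ℕ), |δ k * v k 0 - c'| < ε / 2 := by
      simpa only [Real.dist_eq] using Metric.tendsto_nhds.1 hc' (ε / 2) (by positivity)
    have h2 : ∀ᶠ k in (𝒰 : Filter ℕ), δ k * ((C + 1) * R) < ε / 2 := by
      have : Tendsto (fun k => δ k * ((C + 1) * R)) 𝒰 (𝓝 0) := by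
        simpa using hδ𝒰.mul_const ((C + 1) * R)
      exact this.eventually (gt_mem_nhds (by positivity))
    filter_upwards [h1, h2] with k hk1 hk2 x
    have h3 : δ k * v k x - c' = δ k * u k x + (δ k * v k 0 - c') := by simp only [hu]; ring
    have h4 : |δ k * u k x| ≤ δ k * ((C + 1) * R) := by
      rw [abs_mul, abs_of_pos (hδpos k)]
      exact mul_le_mul_of_nonneg_left (hub k x) (hδpos k).le
    rw [h3]
    exact (abs_add_le _ _).trans (by linarith)
  have hunif : ∀ x₀, ∀ ε > 0, ∀ᶠ k in (𝒰 : Filter ℕ), ∀ x ∈ Metric.closedBall x₀ 1,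
      |u k x - w x| ≤ ε := fun x₀ ε hε =>
    eventually_forall_abs_sub_le (by positivity) hul hwl hw (isCompact_closedBall x₀ 1) hε
  have hkc := continuous_kinetic (n := n)
  refine ⟨-c', w, isCellSolution_iff.2 ⟨hwc, hwp, ?_, ?_⟩⟩
  · refine isViscSub_of_forall_exists (by fun_prop) hwc fun x₀ ε hε => ?_
    obtain ⟨k, hk1, hk2⟩ := ((hsmall ε hε).and (hunif x₀ ε hε)).exists
    refine ⟨u k, huc k, fun φ hφ x hx => ?_, fun x hx => ?_, ?_⟩
    · have := hvsub k φ hφ x (by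
        filter_upwards [hx] with y hy
        simp only [hu] at hy
        linarith)
      linarith [(abs_le.1 (hk1 x)).1]
    · linarith [(abs_le.1 (hk2 x hx)).2]
    · linarith [(abs_le.1 (hk2 x₀ (Metric.mem_closedBall_self zero_le_one))).1]
  · refine isViscSuper_of_isViscSub_neg (isViscSub_of_forall_exists (by fun_prop) hwc.neg
      fun x₀ ε hε => ?_)
    obtain ⟨k, hk1, hk2⟩ := ((hsmall ε hε).and (hunif x₀ ε hε)).exists
    refine ⟨fun x => - u k x, (huc k).neg, fun φ hφ x hx => ?_, fun x hx => ?_, ?_⟩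
    · have := (hvsup k).isViscSub_neg φ hφ x (by
        filter_upwards [hx] with y hy
        simp only [hu] at hy
        linarith)
      dsimp only at this
      linarith [(abs_le.1 (hk1 x)).2]
    · linarith [(abs_le.1 (hk2 x hx)).1]
    · linarith [(abs_le.1 (hk2 x₀ (Metric.mem_closedBall_self zero_le_one))).2]

end Existence

/-! ### Uniqueness, test-function bounds and rescaling. -/

section EffectiveHamiltonian

variable {n : ℕ}

theorem exists_isCellSolution_effectiveHamiltonian {V : EuclideanSpace ℝ (Fin n) → ℝ}
    (hVc : Continuous V) (hVp : IsZPeriodic V) (p : EuclideanSpace ℝ (Fin n)) :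
    ∃ v, IsCellSolution kinetic V p (effectiveHamiltonian kinetic V p) v :=
  Classical.epsilon_spec (exists_isCellSolution hVc hVp p)

/-- A solution of the cell problem on a larger torus identifies the effective Hamiltonian. -/
theorem effectiveHamiltonian_eq {V v : EuclideanSpace ℝ (Fin n) → ℝ}
    (hV : UniformContinuous V) (hVp : IsZPeriodic V) {p : EuclideanSpace ℝ (Fin n)} {c : ℝ}
    {N : ℕ} (hN : 0 < N) (hvc : Continuous v) (hvp : IsPeriodicWith N v)
    (hsub : IsViscSub (fun x _ q => kinetic (p + q) + V x - c) v)
    (hsup : IsViscSuper (fun x _ q => kinetic (p + q) + V x - c) v) :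
    effectiveHamiltonian kinetic V p = c := by
  obtain ⟨w, hw⟩ := exists_isCellSolution_effectiveHamiltonian hV.continuous hVp p
  obtain ⟨h1, h2, h3, h4⟩ := isCellSolution_iff.1 hw
  exact le_antisymm
    (hsub.le_of_isViscSuper (H := fun q => kinetic (p + q)) hN hV hvc hvp h4 h1
      (h2.isPeriodicWith N))
    (h3.le_of_isViscSuper (H := fun q => kinetic (p + q)) hN hV h1 (h2.isPeriodicWith N)
      hsup hvc hvp)

theorem effectiveHamiltonian_le {V w : EuclideanSpace ℝ (Fin n) → ℝ} (hVc : Continuous V)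
    (hVp : IsZPeriodic V) {p : EuclideanSpace ℝ (Fin n)} {b : ℝ} {N : ℕ} (hN : 0 < N)
    (hw : ContDiff ℝ 1 w) (hwp : IsPeriodicWith N w)
    (h : ∀ x, kinetic (p + gradient w x) + V x ≤ b) : effectiveHamiltonian kinetic V p ≤ b := by
  obtain ⟨v, hv⟩ := exists_isCellSolution_effectiveHamiltonian hVc hVp p
  obtain ⟨h1, h2, -, h4⟩ := isCellSolution_iff.1 hv
  exact h4.le_of_contDiff (G := fun x q => kinetic (p + q) + V x) hN h1 (h2.isPeriodicWith N)
    hw hwp h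

theorem le_effectiveHamiltonian {V w : EuclideanSpace ℝ (Fin n) → ℝ} (hVc : Continuous V)
    (hVp : IsZPeriodic V) {p : EuclideanSpace ℝ (Fin n)} {b : ℝ} {N : ℕ} (hN : 0 < N)
    (hw : ContDiff ℝ 1 w) (hwp : IsPeriodicWith N w)
    (h : ∀ x, b ≤ kinetic (p + gradient w x) + V x) : b ≤ effectiveHamiltonian kinetic V p := by
  obtain ⟨v, hv⟩ := exists_isCellSolution_effectiveHamiltonian hVc hVp p
  obtain ⟨h1, h2, h3, -⟩ := isCellSolution_iff.1 hv
  exact h3.le_of_contDiff (G := fun x q => kinetic (p + q) + V x) hN h1 (h2.isPeriodicWith N)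
    hw hwp h

/-- The outer factor `c` cancels the inner `c⁻¹` in the gradient, so the momentum is unchanged.
Positivity of `c` keeps maxima maxima. -/
theorem IsViscSub.const_mul_comp {H V₁ V₂ v : EuclideanSpace ℝ (Fin n) → ℝ} {a c : ℝ}
    (hc : 0 < c) {x₀ : EuclideanSpace ℝ (Fin n)} (hV : ∀ x, V₁ x = V₂ (c⁻¹ • x + x₀))
    (hv : IsViscSub (fun x _ q => H q + V₂ x - a) v) :
    IsViscSub (fun x _ q => H q + V₁ x - a) (fun x => c * v (c⁻¹ • x + x₀)) := by
  intro φ hφ x hx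
  set ψ : EuclideanSpace ℝ (Fin n) → ℝ := fun y => c⁻¹ * φ (c • y + -(c • x₀)) with hψ
  have hψs : ContDiff ℝ 1 ψ :=
    contDiff_const.mul (hφ.comp ((contDiff_id.const_smul c).add contDiff_const))
  have hpt : ∀ y, c • (c⁻¹ • y + x₀) + -(c • x₀) = y := fun y => by
    rw [smul_add, smul_inv_smul₀ hc.ne', add_neg_cancel_right]
  have hpt' : ∀ y, c⁻¹ • (c • y + -(c • x₀)) + x₀ = y := fun y => by
    rw [smul_add, inv_smul_smul₀ hc.ne', smul_neg, inv_smul_smul₀ hc.ne', neg_add_cancel_right]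
  have hg : gradient ψ (c⁻¹ • x + x₀) = gradient φ x := by
    have h1 : HasGradientAt φ (gradient φ x) (c • (c⁻¹ • x + x₀) + -(c • x₀)) := by
      rw [hpt]; exact hasGradientAt_of_contDiff hφ x
    have h2 := hasGradientAt_const_mul c⁻¹ (hasGradientAt_comp_smul_add c (-(c • x₀)) h1)
    rw [inv_smul_smul₀ hc.ne'] at h2
    exact h2.gradient
  have h := hv ψ hψs (c⁻¹ • x + x₀) (by
    have hcont : Continuous fun y : EuclideanSpace ℝ (Fin n) => c • y + -(c • x₀) := by fun_prop
    have ht := hcont.tendsto (c⁻¹ • x + x₀)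
    rw [hpt] at ht
    filter_upwards [ht.eventually hx] with y hy
    rw [hpt'] at hy
    have h3 : ∀ s, v s - ψ s = c⁻¹ * (c * v s - φ (c • s + -(c • x₀))) := fun s => by
      simp only [hψ]; field_simp
    rw [h3, h3, hpt]
    exact mul_le_mul_of_nonneg_left hy (inv_nonneg.2 hc.le))
  rw [hg] at h
  simpa only [hV] using h

theorem IsViscSuper.const_mul_comp {H V₁ V₂ v : EuclideanSpace ℝ (Fin n) → ℝ} {a c : ℝ}
    (hc : 0 < c) {x₀ : EuclideanSpace ℝ (Fin n)} (hV : ∀ x, V₁ x = V₂ (c⁻¹ • x + x₀))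
    (hv : IsViscSuper (fun x _ q => H q + V₂ x - a) v) :
    IsViscSuper (fun x _ q => H q + V₁ x - a) (fun x => c * v (c⁻¹ • x + x₀)) := by
  have h1 : IsViscSub (fun x _ q => -H (-q) + -V₂ x - -a) (fun x => - v x) := by
    intro φ hφ x hx
    linarith [hv.isViscSub_neg φ hφ x hx]
  have h2 := h1.const_mul_comp (V₁ := fun x => - V₁ x) (H := fun q => -H (-q)) hc
    (fun x => by rw [hV])
  refine isViscSuper_of_isViscSub_neg fun φ hφ x hx => ?_
  have h3 := h2 φ hφ x (by simpa only [mul_neg] using hx)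
  linarith

/-- Positive rational rescalings and translations preserve the effective Hamiltonian. -/
theorem effectiveHamiltonian_eq_of_rescale {V₁ V₂ : EuclideanSpace ℝ (Fin n) → ℝ}
    (hV₁ : UniformContinuous V₁) (hV₁p : IsZPeriodic V₁) (hV₂ : UniformContinuous V₂)
    (hV₂p : IsZPeriodic V₂) {c : ℚ} (hc : 0 < c) {x₀ : EuclideanSpace ℝ (Fin n)}
    (h : ∀ x, V₁ x = V₂ ((c : ℝ)⁻¹ • x + x₀)) (p : EuclideanSpace ℝ (Fin n)) :
    effectiveHamiltonian kinetic V₁ p = effectiveHamiltonian kinetic V₂ p := by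
  obtain ⟨v, hv⟩ := exists_isCellSolution_effectiveHamiltonian hV₂.continuous hV₂p p
  obtain ⟨h1, h2, h3, h4⟩ := isCellSolution_iff.1 hv
  have hc' : (0 : ℝ) < c := by exact_mod_cast hc
  -- The numerator of `c` serves as the period of the rescaled solution: a shift by `c.num` becomes,
  -- after division by `c`, a shift by the integer `c.den`.
  have hnum : 0 < c.num.toNat := by
    have := Rat.num_pos.2 hc
    omega
  refine effectiveHamiltonian_eq hV₁ hV₁p hnum (v := fun x => c * v ((c : ℝ)⁻¹ • x + x₀))
    (by fun_prop) (fun z x => ?_)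
    (h3.const_mul_comp (H := fun q => kinetic (p + q)) hc' h)
    (h4.const_mul_comp (H := fun q => kinetic (p + q)) hc' h)
  have hnum' : ((c.num.toNat : ℕ) : ℝ) = c * c.den := by
    have e1 : ((c.num.toNat : ℕ) : ℤ) = c.num := Int.toNat_of_nonneg (Rat.num_pos.2 hc).le
    have e2 : (c.num : ℚ) = c * c.den := (Rat.mul_den_eq_num c).symm
    have e3 : ((c.num.toNat : ℕ) : ℚ) = c * c.den := by
      rw [← e2, ← Int.cast_natCast, e1]
    exact_mod_cast e3
  have hz : (c : ℝ)⁻¹ • (x + ((c.num.toNat : ℕ) : ℝ) • intVec z) + x₀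
      = ((c : ℝ)⁻¹ • x + x₀) + intVec (fun i => c.den * z i) := by
    rw [← natCast_smul_intVec, smul_add, smul_smul, hnum', inv_mul_cancel_left₀ hc'.ne']
    abel
  simp only [hz]
  rw [h2]

end EffectiveHamiltonian

/-! ### Sine sums as correctors. -/

section SinSum

theorem hasGradientAt_sum {ι E : Type*} [NormedAddCommGroup E] [InnerProductSpace ℝ E]
    [CompleteSpace E] {s : Finset ι} {f : ι → E → ℝ} {f' : ι → E} {x : E}
    (h : ∀ i ∈ s, HasGradientAt (f i) (f' i) x) :
    HasGradientAt (fun y => ∑ i ∈ s, f i y) (∑ i ∈ s, f' i) x := by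
  classical
  induction s using Finset.induction_on with
  | empty => simpa using hasGradientAt_const x (0 : ℝ)
  | insert i s hi ih =>
    simp only [Finset.sum_insert hi]
    exact hasGradientAt_add (h i (Finset.mem_insert_self i s))
      (ih fun j hj => h j (Finset.mem_insert_of_mem hj))

variable {n : ℕ} {ι : Type*} [Fintype ι]

/-- `∑ i, c i * sin ⟪κ i, x⟫`. -/
noncomputable def sinSum (c : ι → ℝ) (κ : ι → EuclideanSpace ℝ (Fin n))
    (x : EuclideanSpace ℝ (Fin n)) : ℝ :=
  ∑ i, c i * Real.sin (inner ℝ (κ i) x)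

theorem contDiff_sinSum (c : ι → ℝ) (κ : ι → EuclideanSpace ℝ (Fin n)) :
    ContDiff ℝ 1 (sinSum c κ) := by
  unfold sinSum
  exact ContDiff.sum fun i _ =>
    contDiff_const.mul (Real.contDiff_sin.comp (contDiff_const.inner ℝ contDiff_id))

theorem hasGradientAt_sinSum (c : ι → ℝ) (κ : ι → EuclideanSpace ℝ (Fin n))
    (x : EuclideanSpace ℝ (Fin n)) :
    HasGradientAt (sinSum c κ) (∑ i, (c i * Real.cos (inner ℝ (κ i) x)) • κ i) x := by
  refine hasGradientAt_sum fun i _ => ?_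
  rw [mul_smul]
  exact hasGradientAt_const_mul (c i)
    (hasGradientAt_comp (Real.hasDerivAt_sin _) (hasGradientAt_inner (κ i) x))

theorem norm_gradient_sinSum_le (c : ι → ℝ) (κ : ι → EuclideanSpace ℝ (Fin n))
    (x : EuclideanSpace ℝ (Fin n)) : ‖gradient (sinSum c κ) x‖ ≤ ∑ i, |c i| * ‖κ i‖ := by
  rw [(hasGradientAt_sinSum c κ x).gradient]
  refine (norm_sum_le _ _).trans (Finset.sum_le_sum fun i _ => ?_)
  rw [norm_smul, Real.norm_eq_abs, abs_mul]
  have := mul_le_mul_of_nonneg_left (Real.abs_cos_le_one (inner ℝ (κ i) x)) (abs_nonneg (c i))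
  gcongr
  linarith

theorem inner_intVec (k z : Fin n → ℤ) :
    inner ℝ (intVec k) (intVec z) = ((∑ i, k i * z i : ℤ) : ℝ) := by
  simp [intVec, PiLp.inner_apply, mul_comm]

theorem isPeriodicWith_sinSum {c : ι → ℝ} {κ : ι → EuclideanSpace ℝ (Fin n)} {N : ℕ}
    (h : ∀ i, ∃ k : Fin n → ℤ, (N : ℝ) • κ i = (2 * Real.pi) • intVec k) :
    IsPeriodicWith N (sinSum c κ) := by
  intro z x
  refine Finset.sum_congr rfl fun i _ => ?_
  obtain ⟨k, hk⟩ := h i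
  have h1 : inner ℝ (κ i) (x + (N : ℝ) • intVec z)
      = inner ℝ (κ i) x + ((∑ i, k i * z i : ℤ) : ℝ) * (2 * Real.pi) := by
    rw [inner_add_right, inner_smul_right, ← inner_intVec, mul_comm _ (2 * Real.pi),
      ← real_inner_smul_left, hk, real_inner_smul_left]
  rw [h1, Real.sin_add_int_mul_two_pi]

end SinSum

/-! ### Expansion of the effective Hamiltonian at large momentum. -/

section Expansion

variable {n : ℕ}

theorem intVec_add (k l : Fin n → ℤ) : intVec (k + l) = intVec k + intVec l := by
  ext i; simp [intVec]

theorem intVec_sub (k l : Fin n → ℤ) : intVec (k - l) = intVec k - intVec l := by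
  ext i; simp [intVec]

/-- Two correctors give the expansion of the effective Hamiltonian along a ray up to `τ⁻⁴`. -/
theorem exists_abs_effectiveHamiltonian_sub_le {V w₁ w₂ : EuclideanSpace ℝ (Fin n) → ℝ}
    (hVc : Continuous V) (hVp : IsZPeriodic V) {N : ℕ} (hN : 0 < N) (hw₁ : ContDiff ℝ 1 w₁)
    (hw₂ : ContDiff ℝ 1 w₂) (hp₁ : IsPeriodicWith N w₁) (hp₂ : IsPeriodicWith N w₂)
    {B₁ B₂ a C : ℝ} (hB₁ : ∀ x, ‖gradient w₁ x‖ ≤ B₁) (hB₂ : ∀ x, ‖gradient w₂ x‖ ≤ B₂)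
    {Q : EuclideanSpace ℝ (Fin n)} (h₁ : ∀ x, inner ℝ Q (gradient w₁ x) + V x = a)
    (h₂ : ∀ x, inner ℝ Q (gradient w₂ x) + ‖gradient w₁ x‖ ^ 2 / 2 = C) :
    ∃ K, ∀ τ : ℝ, 1 ≤ τ →
      |effectiveHamiltonian kinetic V (τ • Q) - (τ ^ 2 * ‖Q‖ ^ 2 / 2 + a + C / τ ^ 2)|
        ≤ K / τ ^ 4 := by
  have hB₁0 : 0 ≤ B₁ := (norm_nonneg _).trans (hB₁ 0)
  have hB₂0 : 0 ≤ B₂ := (norm_nonneg _).trans (hB₂ 0)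
  refine ⟨B₁ * B₂ + B₂ ^ 2 / 2, fun τ hτ => ?_⟩
  have hτ0 : 0 < τ := by linarith
  -- The powers of `τ` are matched to the momentum `τ Q`: `w₁` cancels the oscillation of `V` at
  -- order `τ⁰`, and `w₂` that of `|Dw₁|² / 2` at order `τ⁻²`. What is left is exactly of order
  -- `τ⁻⁴`.
  set w : EuclideanSpace ℝ (Fin n) → ℝ := fun x => τ⁻¹ * w₁ x + (τ ^ 3)⁻¹ * w₂ x with hw
  have hws : ContDiff ℝ 1 w := (contDiff_const.mul hw₁).add (contDiff_const.mul hw₂)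
  have hwp : IsPeriodicWith N w := fun z x => by simp only [hw, hp₁ z x, hp₂ z x]
  have hwg : ∀ x, gradient w x = τ⁻¹ • gradient w₁ x + (τ ^ 3)⁻¹ • gradient w₂ x := fun x =>
    (hasGradientAt_add (hasGradientAt_const_mul _ (hasGradientAt_of_contDiff hw₁ x))
      (hasGradientAt_const_mul _ (hasGradientAt_of_contDiff hw₂ x))).gradient
  have hval : ∀ x, kinetic (τ • Q + gradient w x) + V x
      = τ ^ 2 * ‖Q‖ ^ 2 / 2 + a + C / τ ^ 2
        + (inner ℝ (gradient w₁ x) (gradient w₂ x) + ‖gradient w₂ x‖ ^ 2 / 2 / τ ^ 2) / τ ^ 4 := by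
    intro x
    rw [hwg, kinetic, norm_add_sq_real, norm_smul, inner_add_right, norm_add_sq_real, norm_smul,
      norm_smul, real_inner_smul_left, real_inner_smul_left, real_inner_smul_left,
      real_inner_smul_right, real_inner_smul_right, real_inner_smul_right, Real.norm_eq_abs,
      Real.norm_eq_abs, Real.norm_eq_abs, mul_pow, mul_pow, mul_pow, sq_abs, sq_abs, sq_abs,
      ← h₂ x, ← h₁ x]
    field_simp
    ring
  have hres : ∀ x, |(inner ℝ (gradient w₁ x) (gradient w₂ x)
      + ‖gradient w₂ x‖ ^ 2 / 2 / τ ^ 2) / τ ^ 4| ≤ (B₁ * B₂ + B₂ ^ 2 / 2) / τ ^ 4 := by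
    intro x
    rw [abs_div, abs_of_pos (by positivity : 0 < τ ^ 4)]
    gcongr
    refine (abs_add_le _ _).trans (add_le_add ?_ ?_)
    · refine (abs_real_inner_le_norm _ _).trans ?_
      exact mul_le_mul (hB₁ x) (hB₂ x) (norm_nonneg _) hB₁0
    · rw [abs_of_nonneg (by positivity)]
      have h1 : ‖gradient w₂ x‖ ^ 2 ≤ B₂ ^ 2 := pow_le_pow_left₀ (norm_nonneg _) (hB₂ x) 2
      exact (div_le_self (by positivity) (one_le_pow₀ hτ)).trans (by linarith)
  have hup := effectiveHamiltonian_le hVc hVp (p := τ • Q)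
    (b := τ ^ 2 * ‖Q‖ ^ 2 / 2 + a + C / τ ^ 2 + (B₁ * B₂ + B₂ ^ 2 / 2) / τ ^ 4) hN hws hwp
    (fun x => by rw [hval x]; linarith [(abs_le.1 (hres x)).2])
  have hlo := le_effectiveHamiltonian hVc hVp (p := τ • Q)
    (b := τ ^ 2 * ‖Q‖ ^ 2 / 2 + a + C / τ ^ 2 - (B₁ * B₂ + B₂ ^ 2 / 2) / τ ^ 4) hN hws hwp
    (fun x => by rw [hval x]; linarith [(abs_le.1 (hres x)).1])
  exact abs_le.2 ⟨by linarith, by linarith⟩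

variable {ι : Type*} [Fintype ι]

/-- The expansion for a potential whose first corrector is a sine sum; the second corrector removes
all nonresonant products of two modes. -/
theorem exists_abs_effectiveHamiltonian_sub_le_of_sinSum {V : EuclideanSpace ℝ (Fin n) → ℝ}
    (hVc : Continuous V) (hVp : IsZPeriodic V) {N : ℕ} (hN : 0 < N) {c : ι → ℝ}
    {κ : ι → EuclideanSpace ℝ (Fin n)}
    (hκ : ∀ i, ∃ k : Fin n → ℤ, (N : ℝ) • κ i = (2 * Real.pi) • intVec k)
    {Q : EuclideanSpace ℝ (Fin n)} {a C : ℝ}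
    (h₁ : ∀ x, ∑ i, c i * Real.cos (inner ℝ (κ i) x) * inner ℝ Q (κ i) + V x = a)
    (h₂ : ∀ x, ∑ i, ∑ j, c i * c j * inner ℝ (κ i) (κ j) / 4 *
      ((if inner ℝ Q (κ i + κ j) = 0 then Real.cos (inner ℝ (κ i + κ j) x) else 0) +
      (if inner ℝ Q (κ i - κ j) = 0 then Real.cos (inner ℝ (κ i - κ j) x) else 0)) = C) :
    ∃ K, ∀ τ : ℝ, 1 ≤ τ →
      |effectiveHamiltonian kinetic V (τ • Q) - (τ ^ 2 * ‖Q‖ ^ 2 / 2 + a + C / τ ^ 2)|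
        ≤ K / τ ^ 4 := by
  set κ₂ : (ι × ι) ⊕ (ι × ι) → EuclideanSpace ℝ (Fin n) :=
    Sum.elim (fun ij => κ ij.1 + κ ij.2) (fun ij => κ ij.1 - κ ij.2) with hκ₂
  -- Each product of cosines is split into its sum and difference frequencies, and each is divided
  -- by its frequency along `Q`. For a resonant frequency division by zero gives coefficient `0`;
  -- these terms are left to the hypothesis `h₂`.
  set c₂ : (ι × ι) ⊕ (ι × ι) → ℝ :=
    Sum.elim (fun ij => -(c ij.1 * c ij.2 * inner ℝ (κ ij.1) (κ ij.2) / 4)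
        / inner ℝ Q (κ ij.1 + κ ij.2))
      (fun ij => -(c ij.1 * c ij.2 * inner ℝ (κ ij.1) (κ ij.2) / 4)
        / inner ℝ Q (κ ij.1 - κ ij.2)) with hc₂
  refine exists_abs_effectiveHamiltonian_sub_le hVc hVp hN (contDiff_sinSum c κ)
    (contDiff_sinSum c₂ κ₂) (isPeriodicWith_sinSum hκ) (isPeriodicWith_sinSum ?_)
    (norm_gradient_sinSum_le c κ) (norm_gradient_sinSum_le c₂ κ₂) (fun x => ?_) (fun x => ?_)
  · rintro (⟨i, j⟩ | ⟨i, j⟩)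
    · obtain ⟨k, hk⟩ := hκ i
      obtain ⟨l, hl⟩ := hκ j
      exact ⟨k + l, by simp only [hκ₂, Sum.elim_inl, smul_add, hk, hl, intVec_add]⟩
    · obtain ⟨k, hk⟩ := hκ i
      obtain ⟨l, hl⟩ := hκ j
      exact ⟨k - l, by simp only [hκ₂, Sum.elim_inr, smul_sub, hk, hl, intVec_sub]⟩
  · rw [(hasGradientAt_sinSum c κ x).gradient, inner_sum, ← h₁ x]
    simp only [real_inner_smul_right]
  · rw [(hasGradientAt_sinSum c κ x).gradient, (hasGradientAt_sinSum c₂ κ₂ x).gradient, ← h₂ x,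
      ← real_inner_self_eq_norm_sq, sum_inner, inner_sum, Fintype.sum_sum_type,
      Fintype.sum_prod_type, Fintype.sum_prod_type, Finset.sum_div, ← Finset.sum_add_distrib,
      ← Finset.sum_add_distrib]
    refine Finset.sum_congr rfl fun i _ => ?_
    rw [inner_sum, Finset.sum_div, ← Finset.sum_add_distrib, ← Finset.sum_add_distrib]
    refine Finset.sum_congr rfl fun j _ => ?_
    have hprod : Real.cos (inner ℝ (κ i) x) * Real.cos (inner ℝ (κ j) x)
        = (Real.cos (inner ℝ (κ i + κ j) x) + Real.cos (inner ℝ (κ i - κ j) x)) / 2 := by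
      rw [inner_add_left, inner_sub_left, Real.cos_add, Real.cos_sub]
      ring
    have hinner : inner ℝ ((c i * Real.cos (inner ℝ (κ i) x)) • κ i)
          ((c j * Real.cos (inner ℝ (κ j) x)) • κ j)
        = c i * c j * inner ℝ (κ i) (κ j) *
          ((Real.cos (inner ℝ (κ i + κ j) x) + Real.cos (inner ℝ (κ i - κ j) x)) / 2) := by
      rw [real_inner_smul_left, real_inner_smul_right, ← hprod]
      ring
    rw [hinner]
    simp only [hκ₂, hc₂, Sum.elim_inl, Sum.elim_inr, real_inner_smul_right]
    have hcancel : ∀ A B ω : ℝ, -A / ω * B * ω = (if ω = 0 then A * B else 0) - A * B := by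
      intro A B ω
      split_ifs with hω
      · simp [hω]
      · field_simp
        ring
    rw [hcancel, hcancel]
    split_ifs <;> ring

end Expansion

/-! ### Prescribing inner products with independent vectors. -/

section LinearAlgebra

/-- Define a functional on the span by its values on the basis, extend it to the space, and
represent it by Riesz. -/
theorem exists_forall_inner_eq {E ι : Type*} [NormedAddCommGroup E] [InnerProductSpace ℝ E]
    [FiniteDimensional ℝ E] {v : ι → E} (hv : LinearIndependent ℝ v) (b : ι → ℝ) :
    ∃ x, ∀ i, inner ℝ (v i) x = b i := by
  obtain ⟨g, hg⟩ := LinearMap.exists_extend ((Module.Basis.span hv).constr ℝ b)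
  refine ⟨(InnerProductSpace.toDual ℝ E).symm (LinearMap.toContinuousLinearMap g), fun i => ?_⟩
  rw [real_inner_comm, InnerProductSpace.toDual_symm_apply]
  have h1 := LinearMap.congr_fun hg (Module.Basis.span hv i)
  rw [Module.Basis.constr_basis] at h1
  rw [← h1]
  simp [Module.Basis.span_apply]

end LinearAlgebra

/-! ### Potentials in amplitude-phase form; nonresonant and resonant expansions. -/

section PhasePotential

variable {n : ℕ} {ι : Type*} [Fintype ι]

/-- `a + ∑ j, 2 r_j cos (2π k_j ⬝ x + φ_j)`. -/
noncomputable def phasePotential (a : ℝ) (r φ : ι → ℝ) (k : ι → Fin n → ℤ)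
    (x : EuclideanSpace ℝ (Fin n)) : ℝ :=
  a + ∑ j, 2 * r j * Real.cos (inner ℝ ((2 * Real.pi) • intVec (k j)) x + φ j)

theorem uniformContinuous_phasePotential (a : ℝ) (r φ : ι → ℝ) (k : ι → Fin n → ℤ) :
    UniformContinuous (phasePotential a r φ k) := by
  have hcos : UniformContinuous Real.cos := Real.lipschitzWith_cos.uniformContinuous
  have h : ∀ s : Finset ι, UniformContinuous fun x => a + ∑ j ∈ s, 2 * r j *
      Real.cos (inner ℝ ((2 * Real.pi) • intVec (k j)) x + φ j) := by
    classical
    intro s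
    induction s using Finset.induction_on with
    | empty => simpa using uniformContinuous_const
    | insert j s hj ih =>
      simp only [Finset.sum_insert hj, add_left_comm a]
      refine UniformContinuous.add ?_ ih
      refine UniformContinuous.const_mul' (hcos.comp ?_) _
      exact ((innerSL ℝ ((2 * Real.pi) • intVec (k j))).uniformContinuous).add
        uniformContinuous_const
  exact h Finset.univ

theorem isZPeriodic_phasePotential (a : ℝ) (r φ : ι → ℝ) (k : ι → Fin n → ℤ) :
    IsZPeriodic (phasePotential a r φ k) := by
  intro z x
  unfold phasePotential
  congr 1
  refine Finset.sum_congr rfl fun j _ => ?_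
  rw [inner_add_right, real_inner_smul_left (intVec (k j)) (intVec z), inner_intVec,
    mul_comm (2 * Real.pi) (((∑ i, k j i * z i : ℤ) : ℝ)), add_right_comm,
    Real.cos_add_int_mul_two_pi]

/-- Linearly independent modes: two phase potentials with the same amplitudes and modes differ by a
translation. -/
theorem exists_phasePotential_comp_add {k : ι → Fin n → ℤ}
    (hk : LinearIndependent ℝ fun j => intVec (k j)) (a : ℝ) (r φ φ' : ι → ℝ) :
    ∃ x₀, ∀ x, phasePotential a r φ' k x = phasePotential a r φ k (x + x₀) := by
  obtain ⟨x₀, hx₀⟩ := exists_forall_inner_eq hk fun j => (φ' j - φ j) / (2 * Real.pi)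
  refine ⟨x₀, fun x => ?_⟩
  unfold phasePotential
  congr 1
  refine Finset.sum_congr rfl fun j _ => ?_
  have h : inner ℝ ((2 * Real.pi) • intVec (k j)) x₀ = φ' j - φ j := by
    rw [real_inner_smul_left, hx₀]
    field_simp
  rw [inner_add_right, h]
  congr 2
  ring

theorem phasePotential_neg_apply (a : ℝ) (r φ : ι → ℝ) (k : ι → Fin n → ℤ)
    (x : EuclideanSpace ℝ (Fin n)) :
    phasePotential a r φ k (-x) = phasePotential a r (fun j => - φ j) k x := by
  unfold phasePotential
  congr 1
  refine Finset.sum_congr rfl fun j _ => ?_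
  rw [inner_neg_right, ← Real.cos_neg (_ + - φ j)]
  congr 2
  ring

/-- With linearly independent modes only the absolute values of the amplitudes matter for the
effective Hamiltonian. -/
theorem effectiveHamiltonian_phasePotential_eq {k : ι → Fin n → ℤ}
    (hk : LinearIndependent ℝ fun j => intVec (k j)) (a : ℝ) {r r' : ι → ℝ} (φ φ' : ι → ℝ)
    (hr : ∀ j, |r' j| = |r j|) (p : EuclideanSpace ℝ (Fin n)) :
    effectiveHamiltonian kinetic (phasePotential a r' φ' k) p
      = effectiveHamiltonian kinetic (phasePotential a r φ k) p := by
  classical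
  -- A change of sign of an amplitude is a phase shift by `π`, and phase shifts are translations.
  have hsign : phasePotential a r' φ' k
      = phasePotential a r (fun j => φ' j + if r' j = r j then 0 else Real.pi) k := by
    funext x
    unfold phasePotential
    congr 1
    refine Finset.sum_congr rfl fun j _ => ?_
    by_cases h : r' j = r j
    · simp [h]
    · have h' : r' j = - r j := (abs_eq_abs.1 (hr j)).resolve_left h
      simp only [if_neg h]
      rw [← add_assoc, Real.cos_add_pi, h']
      ring
  obtain ⟨x₀, hx₀⟩ := exists_phasePotential_comp_add hk a r φ
    (fun j => φ' j + if r' j = r j then 0 else Real.pi)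
  rw [hsign]
  refine effectiveHamiltonian_eq_of_rescale (c := 1) (x₀ := x₀)
    (uniformContinuous_phasePotential _ _ _ _) (isZPeriodic_phasePotential _ _ _ _)
    (uniformContinuous_phasePotential _ _ _ _) (isZPeriodic_phasePotential _ _ _ _) one_pos
    (fun x => ?_) p
  rw [hx₀]
  simp

/-- The coefficient of order `τ⁻²` in the expansion of the effective Hamiltonian at `τ Q`, for
nonresonant `Q`. -/
noncomputable def secondOrderCoeff (r : ι → ℝ) (k : ι → Fin n → ℤ)
    (Q : EuclideanSpace ℝ (Fin n)) : ℝ :=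
  ∑ j, r j ^ 2 * ‖intVec (k j)‖ ^ 2 / inner ℝ Q (intVec (k j)) ^ 2

/-- Without resonances only the zero frequency, from a mode paired with itself, survives in the
squared gradient of the first corrector; its mean is the `τ⁻²` coefficient. -/
theorem exists_abs_effectiveHamiltonian_phasePotential_sub_le (a : ℝ) (r : ι → ℝ)
    (k : ι → Fin n → ℤ) {Q : EuclideanSpace ℝ (Fin n)}
    (hadd : ∀ i j, inner ℝ Q (intVec (k i) + intVec (k j)) ≠ 0)
    (hsub : ∀ i j, i ≠ j → inner ℝ Q (intVec (k i) - intVec (k j)) ≠ 0) :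
    ∃ K, ∀ τ : ℝ, 1 ≤ τ →
      |effectiveHamiltonian kinetic (phasePotential a r (fun _ => 0) k) (τ • Q)
        - (τ ^ 2 * ‖Q‖ ^ 2 / 2 + a + secondOrderCoeff r k Q / τ ^ 2)| ≤ K / τ ^ 4 := by
  have hpi := Real.pi_pos
  have hne : ∀ i, inner ℝ Q (intVec (k i)) ≠ 0 := fun i h => by
    have := hadd i i
    rw [inner_add_right, h] at this
    simp at this
  have hκ : ∀ i, inner ℝ Q ((2 * Real.pi) • intVec (k i))
      = (2 * Real.pi) * inner ℝ Q (intVec (k i)) := fun i => real_inner_smul_right _ _ _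
  refine exists_abs_effectiveHamiltonian_sub_le_of_sinSum
    (uniformContinuous_phasePotential _ _ _ _).continuous (isZPeriodic_phasePotential _ _ _ _)
    one_pos (c := fun i => - (2 * r i) / inner ℝ Q ((2 * Real.pi) • intVec (k i)))
    (κ := fun i => (2 * Real.pi) • intVec (k i)) (fun i => ⟨k i, by simp⟩) (fun x => ?_)
    (fun x => ?_)
  · unfold phasePotential
    rw [add_left_comm, ← Finset.sum_add_distrib, Finset.sum_eq_zero, add_zero]
    intro i _
    have := hne i
    rw [hκ, add_zero]
    field_simp
    ring
  · unfold secondOrderCoeff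
    refine Finset.sum_congr rfl fun i _ => ?_
    rw [Finset.sum_eq_single i]
    · have h1 := hne i
      have h2 : inner ℝ Q ((2 * Real.pi) • intVec (k i) + (2 * Real.pi) • intVec (k i)) ≠ 0 := by
        rw [← smul_add, real_inner_smul_right]
        exact mul_ne_zero (by positivity) (hadd i i)
      rw [if_neg h2, sub_self, inner_zero_right, if_pos rfl, inner_zero_left, Real.cos_zero, hκ,
        real_inner_self_eq_norm_sq, norm_smul, Real.norm_eq_abs, mul_pow, sq_abs]
      field_simp
      ring
    · intro j _ hj
      rw [if_neg, if_neg]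
      · ring
      · rw [← smul_sub, real_inner_smul_right]
        exact mul_ne_zero (by positivity) (hsub i j hj.symm)
      · rw [← smul_add, real_inner_smul_right]
        exact mul_ne_zero (by positivity) (hadd i j)
    · simp

/-- Two modes in `1:1` resonance at `Q`: if their directions are not orthogonal and the signs of the
amplitudes are chosen properly, a resonant corrector with doubled period contributes a positive
term of order `τ⁻²`. -/
theorem exists_abs_effectiveHamiltonian_sub_le_of_resonance (a : ℝ) (r : Fin 2 → ℝ)
    (k : Fin 2 → Fin n → ℤ) {Q : EuclideanSpace ℝ (Fin n)}
    (hQ0 : inner ℝ Q (intVec (k 0)) ≠ 0)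
    (hQ : inner ℝ Q (intVec (k 1)) = inner ℝ Q (intVec (k 0)))
    (hk : intVec (k 0) ≠ intVec (k 1))
    (hneg : r 0 * r 1 * inner ℝ (intVec (k 0)) (intVec (k 1)) < 0) :
    ∃ β > 0, ∃ K, ∀ τ : ℝ, 1 ≤ τ →
      |effectiveHamiltonian kinetic (phasePotential a r (fun _ => 0) k) (τ • Q)
        - (τ ^ 2 * ‖Q‖ ^ 2 / 2 + a + (secondOrderCoeff r k Q + β) / τ ^ 2)| ≤ K / τ ^ 4 := by
  have hpi := Real.pi_pos
  set ω := inner ℝ Q (intVec (k 0)) with hω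
  set D := ‖intVec (k 0) - intVec (k 1)‖ ^ 2 with hD
  have hDpos : 0 < D := by
    have := norm_pos_iff.2 (sub_ne_zero.2 hk)
    positivity
  set I := inner ℝ (intVec (k 0)) (intVec (k 1)) with hI
  -- The resonant part of the squared first corrector is `-β cos (2π (k₀ - k₁) · x)`. An extra
  -- corrector `2 S sin (π (k₀ - k₁) · x)` is invisible at order `τ⁰`, being orthogonal to `Q`, and
  -- contributes `S² π² D (1 + cos (2π (k₀ - k₁) · x))`. With `S² π² D = β` the oscillations cancel
  -- and the constant `β` remains; this needs `β > 0`, hence the sign hypothesis.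
  set β := -(2 * (r 0 * r 1 * I) / ω ^ 2) with hβ
  have hβpos : 0 < β := by
    rw [hβ, neg_pos]
    exact div_neg_of_neg_of_pos (by linarith) (by positivity)
  -- the amplitude of the resonant corrector
  set S := Real.sqrt (β / (D * Real.pi ^ 2)) with hS
  have hS2 : S ^ 2 * D * Real.pi ^ 2 = β := by
    rw [hS, Real.sq_sqrt (by positivity)]
    field_simp
  refine ⟨β, hβpos, ?_⟩
  have i0 : inner ℝ Q ((2 * Real.pi) • intVec (k 0)) = 2 * Real.pi * ω := by
    rw [real_inner_smul_right]
  have i1 : inner ℝ Q ((2 * Real.pi) • intVec (k 1)) = 2 * Real.pi * ω := by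
    rw [real_inner_smul_right, hQ]
  have i2 : inner ℝ Q (Real.pi • (intVec (k 0) - intVec (k 1))) = 0 := by
    rw [real_inner_smul_right, inner_sub_right, hQ, sub_self, mul_zero]
  have hω2 : 2 * Real.pi * ω ≠ 0 := by positivity
  refine exists_abs_effectiveHamiltonian_sub_le_of_sinSum
    (uniformContinuous_phasePotential _ _ _ _).continuous (isZPeriodic_phasePotential _ _ _ _)
    -- Period `2`, since the third frequency is half of a lattice frequency.
    two_pos (ι := Fin 3)
    (c := ![-(2 * r 0) / (2 * Real.pi * ω), -(2 * r 1) / (2 * Real.pi * ω), 2 * S])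
    (κ := ![(2 * Real.pi) • intVec (k 0), (2 * Real.pi) • intVec (k 1),
      Real.pi • (intVec (k 0) - intVec (k 1))]) ?_ (fun x => ?_) (fun x => ?_)
  · intro i
    fin_cases i
    · exact ⟨k 0 + k 0, by
        rw [intVec_add]
        simp only [Fin.zero_eta, Matrix.cons_val_zero]
        push_cast
        module⟩
    · exact ⟨k 1 + k 1, by
        rw [intVec_add]
        simp only [Fin.mk_one, Matrix.cons_val_one, Matrix.cons_val_zero]
        push_cast
        module⟩
    · exact ⟨k 0 - k 1, by
        rw [intVec_sub]
        simp only [Fin.reduceFinMk, Matrix.cons_val]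
        push_cast
        module⟩
  · simp only [Fin.sum_univ_three, Matrix.cons_val_zero, Matrix.cons_val_one, Matrix.cons_val, i0,
      i1, i2, phasePotential, Fin.sum_univ_two, add_zero]
    field_simp
    ring
  · have hadd : ∀ u v : EuclideanSpace ℝ (Fin n),
        inner ℝ Q (u + v) = inner ℝ Q u + inner ℝ Q v := fun u v => inner_add_right _ _ _
    have hsub : ∀ u v : EuclideanSpace ℝ (Fin n),
        inner ℝ Q (u - v) = inner ℝ Q u - inner ℝ Q v := fun u v => inner_sub_right _ _ _
    have hω4 : 2 * Real.pi * ω + 2 * Real.pi * ω ≠ 0 := by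
      rw [← two_mul]; positivity
    have hψ : Real.cos (inner ℝ (Real.pi • (intVec (k 0) - intVec (k 1))
        + Real.pi • (intVec (k 0) - intVec (k 1))) x)
        = Real.cos (inner ℝ ((2 * Real.pi) • intVec (k 0) - (2 * Real.pi) • intVec (k 1)) x) := by
      congr 2
      module
    have hψ' : Real.cos (inner ℝ ((2 * Real.pi) • intVec (k 1) - (2 * Real.pi) • intVec (k 0)) x)
        = Real.cos (inner ℝ ((2 * Real.pi) • intVec (k 0) - (2 * Real.pi) • intVec (k 1)) x) := by
      rw [← neg_sub, inner_neg_left, Real.cos_neg]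
    simp only [Fin.sum_univ_three, Matrix.cons_val_zero, Matrix.cons_val_one, Matrix.cons_val, hadd,
      hsub, i0, i1, i2, add_zero, zero_add, sub_zero, zero_sub, sub_self, neg_eq_zero, hω2, hω4,
      if_true, if_false, mul_zero, hψ, hψ', inner_zero_left, Real.cos_zero]
    set co := Real.cos (inner ℝ ((2 * Real.pi) • intVec (k 0) - (2 * Real.pi) • intVec (k 1)) x)
    simp only [secondOrderCoeff, Fin.sum_univ_two, hQ, ← hω, real_inner_smul_left,
      real_inner_smul_right, real_inner_self_eq_norm_sq, ← hI,
      real_inner_comm (intVec (k 0)) (intVec (k 1))]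
    have hβ' : β * ω ^ 2 = -(2 * (r 0 * r 1 * I)) := by rw [hβ]; field_simp
    have n0 : ‖(2 * Real.pi) • intVec (k 0)‖ ^ 2 = 4 * Real.pi ^ 2 * ‖intVec (k 0)‖ ^ 2 := by
      rw [norm_smul, mul_pow, Real.norm_eq_abs, sq_abs]; ring
    have n1 : ‖(2 * Real.pi) • intVec (k 1)‖ ^ 2 = 4 * Real.pi ^ 2 * ‖intVec (k 1)‖ ^ 2 := by
      rw [norm_smul, mul_pow, Real.norm_eq_abs, sq_abs]; ring
    have n2 : ‖Real.pi • (intVec (k 0) - intVec (k 1))‖ ^ 2 = Real.pi ^ 2 * D := by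
      rw [norm_smul, mul_pow, Real.norm_eq_abs, sq_abs]
    rw [n0, n1, n2]
    field_simp
    linear_combination 4 * ω ^ 2 * (co + 1) * hS2 + 4 * co * hβ'

end PhasePotential

/-! ### Separation of variables for orthogonal modes. -/

section Separable

variable {n : ℕ} {ι : Type*} [Fintype ι]

/-- The unit vector of the one-dimensional torus. -/
noncomputable def unitVec : EuclideanSpace ℝ (Fin 1) := intVec fun _ => 1

theorem inner_unitVec (s : EuclideanSpace ℝ (Fin 1)) : inner ℝ unitVec s = s 0 := by
  simp [unitVec, intVec, PiLp.inner_apply]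

theorem inner_unitVec_smul (t : ℝ) : inner ℝ unitVec (t • unitVec) = t := by
  rw [inner_unitVec]
  simp [unitVec, intVec]

theorem kinetic_smul_unitVec (t : ℝ) : kinetic (t • unitVec) = t ^ 2 / 2 := by
  rw [kinetic, ← real_inner_self_eq_norm_sq, real_inner_smul_left, inner_unitVec_smul]
  ring

/-- A sum of functions of one variable each, along the directions `κ j`. -/
noncomputable def ridgeSum (κ : ι → EuclideanSpace ℝ (Fin n))
    (w : ι → EuclideanSpace ℝ (Fin 1) → ℝ) (x : EuclideanSpace ℝ (Fin n)) : ℝ :=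
  ∑ j, ‖κ j‖⁻¹ * w j (inner ℝ (κ j) x • unitVec)

/-- A test function touching a ridge sum with orthogonal directions splits into test functions for
the summands. -/
theorem exists_isLocalMax_of_isLocalMax_ridgeSum {κ : ι → EuclideanSpace ℝ (Fin n)}
    (hκ0 : ∀ j, κ j ≠ 0) (hκ : ∀ i j, i ≠ j → inner ℝ (κ i) (κ j) = 0)
    {w : ι → EuclideanSpace ℝ (Fin 1) → ℝ} {φ : EuclideanSpace ℝ (Fin n) → ℝ}
    (hφ : ContDiff ℝ 1 φ) {x : EuclideanSpace ℝ (Fin n)}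
    (hx : IsLocalMax (fun y => ridgeSum κ w y - φ y) x) :
    (∀ p, kinetic (p + gradient φ x) = kinetic p + ∑ j,
      ((inner ℝ p (κ j) / ‖κ j‖ + inner ℝ (gradient φ x) (κ j) / ‖κ j‖) ^ 2 / 2
        - (inner ℝ p (κ j) / ‖κ j‖) ^ 2 / 2)) ∧
    ∀ j, ∃ ψ : EuclideanSpace ℝ (Fin 1) → ℝ, ContDiff ℝ 1 ψ ∧
      gradient ψ (inner ℝ (κ j) x • unitVec)
        = (inner ℝ (gradient φ x) (κ j) / ‖κ j‖) • unitVec ∧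
      IsLocalMax (fun s => w j s - ψ s) (inner ℝ (κ j) x • unitVec) := by
  classical
  have hpos : ∀ j, 0 < ‖κ j‖ := fun j => norm_pos_iff.2 (hκ0 j)
  set g := gradient φ x with hg
  constructor
  -- The part of the gradient orthogonal to all `κ j` vanishes: the ridge sum is constant along `d`,
  -- so `φ` has a local minimum along that line and `⟪g, d⟫ = ‖d‖² = 0`. The kinetic energy then
  -- splits by Pythagoras.
  · set d := g - ∑ j, (inner ℝ g (κ j) / ‖κ j‖ ^ 2) • κ j with hd
    have hdκ : ∀ j, inner ℝ (κ j) d = 0 := by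
      intro j
      rw [hd, inner_sub_right, inner_sum, Finset.sum_eq_single j]
      · rw [real_inner_smul_right, real_inner_self_eq_norm_sq, real_inner_comm]
        have := (hpos j).ne'
        field_simp
        ring
      · intro i _ hij
        rw [real_inner_smul_right, hκ j i hij.symm, mul_zero]
      · simp
    have hgd : inner ℝ g d = 0 := by
      have hline : HasDerivAt (fun t : ℝ => x + t • d) d 0 := by
        simpa using ((hasDerivAt_id (0 : ℝ)).smul_const d).const_add x
      have hφx : HasFDerivAt φ (InnerProductSpace.toDual ℝ _ g) (x + (0 : ℝ) • d) := by
        rw [zero_smul, add_zero]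
        exact hasGradientAt_iff_hasFDerivAt.1 (hasGradientAt_of_contDiff hφ x)
      have hder := hφx.comp_hasDerivAt (0 : ℝ) hline
      have hmin : IsLocalMin (φ ∘ fun t : ℝ => x + t • d) 0 := by
        have ht : Tendsto (fun t : ℝ => x + t • d) (𝓝 0) (𝓝 x) := by
          simpa using hline.continuousAt.tendsto
        filter_upwards [ht.eventually hx] with t ht
        have hconst : ridgeSum κ w (x + t • d) = ridgeSum κ w x := by
          simp only [ridgeSum, inner_add_right, real_inner_smul_right, hdκ, mul_zero, add_zero]
        simp only [Function.comp_apply, zero_smul, add_zero]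
        linarith
      simpa using hmin.hasDerivAt_eq_zero hder
    have hd0 : d = 0 := by
      have : inner ℝ d d = (0 : ℝ) := by
        conv_lhs => rw [hd]
        rw [inner_sub_left, hgd, sum_inner, Finset.sum_eq_zero, sub_zero]
        intro j _
        rw [real_inner_smul_left, hdκ, mul_zero]
      exact inner_self_eq_zero.1 this
    have hgsum : ∀ q, inner ℝ q g = ∑ j, inner ℝ g (κ j) * inner ℝ q (κ j) / ‖κ j‖ ^ 2 := by
      intro q
      conv_lhs => rw [sub_eq_zero.1 (hd ▸ hd0 : g - _ = 0)]
      rw [inner_sum]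
      refine Finset.sum_congr rfl fun j _ => ?_
      rw [real_inner_smul_right]
      ring
    intro p
    rw [kinetic, kinetic, norm_add_sq_real, ← real_inner_self_eq_norm_sq g, hgsum p, hgsum g,
      add_div, add_div, mul_div_cancel_left₀ _ (two_ne_zero), add_assoc, Finset.sum_div,
      ← Finset.sum_add_distrib]
    congr 1
    refine Finset.sum_congr rfl fun j _ => ?_
    have := (hpos j).ne'
    field_simp
    ring
  · intro j
    have hj := (hpos j).ne'
    set s := inner ℝ (κ j) x • unitVec with hs
    -- A line through `x` along `κ j`, parametrized by the argument of the `j`-th summand; by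
    -- orthogonality all other summands are constant on it.
    set ℓ : EuclideanSpace ℝ (Fin 1) → EuclideanSpace ℝ (Fin n) := fun y =>
      x + (inner ℝ unitVec y - inner ℝ (κ j) x) • ((‖κ j‖ ^ 2)⁻¹ • κ j) with hℓ
    have hℓs : ℓ s = x := by
      simp only [hℓ, hs, inner_unitVec_smul, sub_self, zero_smul, add_zero]
    have hℓκ : ∀ i y, inner ℝ (κ i) (ℓ y) • unitVec
        = if i = j then y else inner ℝ (κ i) x • unitVec := by
      intro i y
      simp only [hℓ, inner_add_right, real_inner_smul_right]
      split_ifs with hij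
      · subst hij
        rw [real_inner_self_eq_norm_sq, inv_mul_cancel₀ (by positivity), mul_one, add_sub_cancel,
          inner_unitVec]
        ext k
        simp [unitVec, intVec, Subsingleton.elim k 0]
      · rw [hκ i j hij]
        simp
    have hℓd : ContDiff ℝ 1 ℓ := by
      have h : ContDiff ℝ 1 fun y : EuclideanSpace ℝ (Fin 1) =>
          inner ℝ unitVec y - inner ℝ (κ j) x :=
        (contDiff_const.inner ℝ contDiff_id).sub contDiff_const
      exact contDiff_const.add (h.smul contDiff_const)
    have hℓ' : HasFDerivAt ℓ ((innerSL ℝ unitVec).smulRight ((‖κ j‖ ^ 2)⁻¹ • κ j)) s :=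
      (((innerSL ℝ unitVec).hasFDerivAt.sub_const _).smul_const _).const_add x
    refine ⟨fun y => ‖κ j‖ * φ (ℓ y), contDiff_const.mul (hφ.comp hℓd), ?_, ?_⟩
    · have h1 : HasGradientAt (fun y => φ (ℓ y)) (((‖κ j‖ ^ 2)⁻¹ * inner ℝ g (κ j)) • unitVec) s := by
        rw [hasGradientAt_iff_hasFDerivAt]
        have h2 : HasFDerivAt φ (InnerProductSpace.toDual ℝ _ g) (ℓ s) := by
          rw [hℓs]
          exact hasGradientAt_iff_hasFDerivAt.1 (hasGradientAt_of_contDiff hφ x)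
        refine (h2.comp s hℓ').congr_fderiv ?_
        ext y
        simp
        ring
      rw [(hasGradientAt_const_mul ‖κ j‖ h1).gradient, smul_smul]
      congr 1
      field_simp
    · have ht : Tendsto ℓ (𝓝 s) (𝓝 x) := by
        have := hℓd.continuous.tendsto s
        rwa [hℓs] at this
      have hsplit : ∀ y, ridgeSum κ w (ℓ y) = ‖κ j‖⁻¹ * w j y
          + ∑ i ∈ Finset.univ.erase j, ‖κ i‖⁻¹ * w i (inner ℝ (κ i) x • unitVec) := by
        intro y
        rw [ridgeSum, ← Finset.add_sum_erase _ _ (Finset.mem_univ j), hℓκ, if_pos rfl]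
        congr 1
        refine Finset.sum_congr rfl fun i hi => ?_
        rw [hℓκ, if_neg (Finset.ne_of_mem_erase hi)]
      filter_upwards [ht.eventually hx] with y hy
      rw [← hℓs, hsplit, hsplit, hℓs] at hy
      have h3 : ‖κ j‖ * (‖κ j‖⁻¹ * w j y - φ (ℓ y)) ≤ ‖κ j‖ * (‖κ j‖⁻¹ * w j s - φ x) :=
        mul_le_mul_of_nonneg_left (by linarith) (hpos j).le
      rw [mul_sub, mul_sub, mul_inv_cancel_left₀ hj, mul_inv_cancel_left₀ hj] at h3
      rw [hℓs]
      exact h3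

/-- The effective Hamiltonian of `2 r cos (2π s)` in one dimension. -/
noncomputable def cosineEffectiveHamiltonian (r α : ℝ) : ℝ :=
  effectiveHamiltonian kinetic
    (phasePotential (n := 1) 0 (fun _ : Fin 1 => r) (fun _ => 0) fun _ _ => 1) (α • unitVec)

/-- Orthogonal modes separate. -/
theorem effectiveHamiltonian_phasePotential_of_orthogonal {k : ι → Fin n → ℤ}
    (hk0 : ∀ j, intVec (k j) ≠ 0)
    (hk : ∀ i j, i ≠ j → inner ℝ (intVec (k i)) (intVec (k j)) = 0) (a : ℝ) (r : ι → ℝ)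
    (p : EuclideanSpace ℝ (Fin n)) :
    effectiveHamiltonian kinetic (phasePotential a r (fun _ => 0) k) p
      = a + kinetic p + ∑ j, (cosineEffectiveHamiltonian (r j)
          (inner ℝ p (intVec (k j)) / ‖intVec (k j)‖)
        - (inner ℝ p (intVec (k j)) / ‖intVec (k j)‖) ^ 2 / 2) := by
  set f : ι → EuclideanSpace ℝ (Fin 1) → ℝ := fun j =>
    phasePotential (n := 1) 0 (fun _ : Fin 1 => r j) (fun _ => 0) fun _ _ => 1 with hf
  set α : ι → ℝ := fun j => inner ℝ p (intVec (k j)) / ‖intVec (k j)‖ with hα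
  have hsol : ∀ j, ∃ w, IsCellSolution kinetic (f j) (α j • unitVec)
      (cosineEffectiveHamiltonian (r j) (α j)) w := fun j =>
    exists_isCellSolution_effectiveHamiltonian
      (uniformContinuous_phasePotential _ _ _ _).continuous (isZPeriodic_phasePotential _ _ _ _) _
  choose w hw using hsol
  have hV : ∀ x, phasePotential a r (fun _ => 0) k x
      = a + ∑ j, f j (inner ℝ (intVec (k j)) x • unitVec) := by
    intro x
    unfold phasePotential
    congr 1
    refine Finset.sum_congr rfl fun j _ => ?_
    simp only [hf, phasePotential, Finset.univ_unique, Finset.sum_singleton, zero_add, add_zero]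
    rw [real_inner_smul_left, real_inner_smul_left _ (_ • unitVec),
      show (intVec fun _ => 1 : EuclideanSpace ℝ (Fin 1)) = unitVec from rfl, inner_unitVec_smul]
  -- The weights `‖κ j‖⁻¹` make the gradient of each ridge a one-dimensional derivative times a unit
  -- vector, so the sum of the one-dimensional solutions solves the full problem.
  refine effectiveHamiltonian_eq (uniformContinuous_phasePotential _ _ _ _)
    (isZPeriodic_phasePotential _ _ _ _) one_pos (v := ridgeSum (fun j => intVec (k j)) w)
    ?_ (IsZPeriodic.isPeriodicWith ?_ 1) ?_ ?_
  · unfold ridgeSum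
    have := fun j => (hw j).continuous
    fun_prop
  · intro z x
    unfold ridgeSum
    refine Finset.sum_congr rfl fun j _ => ?_
    have h1 : inner ℝ (intVec (k j)) (x + intVec z) • unitVec
        = inner ℝ (intVec (k j)) x • unitVec + intVec (fun _ : Fin 1 => ∑ i, k j i * z i) := by
      rw [inner_add_right, inner_intVec, add_smul]
      congr 1
      ext i
      simp [unitVec, intVec]
    rw [h1, (hw j).periodic]
  · intro φ hφ x hx
    obtain ⟨h1, h2⟩ := exists_isLocalMax_of_isLocalMax_ridgeSum hk0 hk hφ hx
    beta_reduce
    rw [h1 p, hV]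
    have h3 : ∀ j, (α j + inner ℝ (gradient φ x) (intVec (k j)) / ‖intVec (k j)‖) ^ 2 / 2
        + f j (inner ℝ (intVec (k j)) x • unitVec) ≤ cosineEffectiveHamiltonian (r j) (α j) := by
      intro j
      obtain ⟨ψ, hψ, hψg, hψm⟩ := h2 j
      have := (hw j).subsolution ψ hψ _ hψm
      rwa [hψg, ← add_smul, kinetic_smul_unitVec] at this
    have h4 := Finset.sum_le_sum fun j (_ : j ∈ Finset.univ) => h3 j
    rw [Finset.sum_add_distrib] at h4
    rw [Finset.sum_sub_distrib, Finset.sum_sub_distrib]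
    linarith
  · intro φ hφ x hx
    -- The splitting lemma concerns maxima, so it is applied to `-w`, `-φ` and the momentum `-p`;
    -- evenness of the kinetic energy returns to `p`.
    have hx' : IsLocalMax (fun y => ridgeSum (fun j => intVec (k j)) (fun j s => - w j s) y
        - (fun y => - φ y) y) x := by
      refine hx.neg.congr (Eventually.of_forall fun y => ?_)
      simp only [ridgeSum, mul_neg, Finset.sum_neg_distrib]
      ring
    obtain ⟨h1, h2⟩ := exists_isLocalMax_of_isLocalMax_ridgeSum hk0 hk hφ.neg hx'
    have hg := (hasGradientAt_neg (hasGradientAt_of_contDiff hφ x)).gradient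
    have h5 : kinetic (p + gradient φ x) = kinetic (-p + gradient (fun y => - φ y) x) := by
      rw [hg, ← neg_add, kinetic, kinetic, norm_neg]
    have h6 : kinetic (-p) = kinetic p := by rw [kinetic, kinetic, norm_neg]
    beta_reduce
    rw [h5, h1 (-p), h6, hV, hg]
    have h3 : ∀ j, cosineEffectiveHamiltonian (r j) (α j) ≤
        (inner ℝ (-p) (intVec (k j)) / ‖intVec (k j)‖
          + inner ℝ (-gradient φ x) (intVec (k j)) / ‖intVec (k j)‖) ^ 2 / 2
        + f j (inner ℝ (intVec (k j)) x • unitVec) := by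
      intro j
      obtain ⟨ψ, hψ, hψg, hψm⟩ := h2 j
      rw [hg] at hψg
      have := (hw j).supersolution (fun s => - ψ s) hψ.neg _ (by
        refine hψm.neg.congr (Eventually.of_forall fun y => ?_)
        ring)
      rw [(hasGradientAt_neg (hasGradientAt_of_contDiff hψ _)).gradient, hψg, ← neg_smul,
        ← add_smul, kinetic_smul_unitVec] at this
      rw [← neg_sq]
      convert this using 4
      rw [inner_neg_left, hα]
      ring
    have h4 := Finset.sum_le_sum fun j (_ : j ∈ Finset.univ) => h3 j
    rw [Finset.sum_add_distrib] at h4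
    have h7 : ∑ j, (inner ℝ (-p) (intVec (k j)) / ‖intVec (k j)‖) ^ 2 / 2 = ∑ j, α j ^ 2 / 2 := by
      refine Finset.sum_congr rfl fun j _ => ?_
      rw [inner_neg_left, neg_div, neg_sq]
    rw [Finset.sum_sub_distrib, Finset.sum_sub_distrib, h7]
    linarith

end Separable

/-! ### Parallel integer vectors and generic orthogonal vectors. -/

section Parallel

variable {n : ℕ}

theorem Parallel.refl (u : EuclideanSpace ℝ (Fin n)) : Parallel u u := ⟨1, one_ne_zero, by simp⟩

theorem Parallel.symm {u w : EuclideanSpace ℝ (Fin n)} (h : Parallel u w) : Parallel w u := by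
  obtain ⟨t, ht, rfl⟩ := h
  exact ⟨t⁻¹, inv_ne_zero ht, by rw [inv_smul_smul₀ ht]⟩

theorem Parallel.trans {u v w : EuclideanSpace ℝ (Fin n)} (h : Parallel u v) (h' : Parallel v w) :
    Parallel u w := by
  obtain ⟨t, ht, rfl⟩ := h
  obtain ⟨s, hs, rfl⟩ := h'
  exact ⟨s * t, mul_ne_zero hs ht, by rw [mul_smul]⟩

theorem intVec_ne_zero {k : Fin n → ℤ} (hk : k ≠ 0) : intVec k ≠ 0 := by
  intro h
  apply hk
  funext i
  have := congrArg (fun x : EuclideanSpace ℝ (Fin n) => x i) h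
  simpa [intVec] using this

/-- The ratio of parallel integer vectors is rational. -/
theorem Parallel.exists_rat {k l : Fin n → ℤ} (hk : k ≠ 0) (h : Parallel (intVec k) (intVec l)) :
    ∃ q : ℚ, q ≠ 0 ∧ intVec l = (q : ℝ) • intVec k := by
  obtain ⟨t, ht, h⟩ := h
  obtain ⟨i, hi⟩ := Function.ne_iff.1 hk
  have hi' : (k i : ℝ) ≠ 0 := by exact_mod_cast hi
  have h1 : (l i : ℝ) = t * k i := by
    simpa [intVec] using congrArg (fun x : EuclideanSpace ℝ (Fin n) => x i) h
  have h2 : t = ((l i / k i : ℚ) : ℝ) := by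
    push_cast
    rw [h1]
    field_simp
  refine ⟨l i / k i, ?_, by rw [← h2]; exact h⟩
  rintro h3
  rw [h3, Rat.cast_zero] at h2
  exact ht h2

/-- A vector orthogonal to `u` and to no vector of a finite set that is not parallel to `u`. -/
theorem exists_inner_eq_zero_forall_inner_ne_zero (u : EuclideanSpace ℝ (Fin n))
    {S : Set (EuclideanSpace ℝ (Fin n))} (hS : S.Finite) (h0 : ∀ f ∈ S, f ≠ 0) :
    ∃ Q, inner ℝ Q u = 0 ∧ ∀ f ∈ S, Parallel u f ∨ inner ℝ Q f ≠ 0 := by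
  have hfin : Finite {f // f ∈ S ∧ ¬ Parallel u f} :=
    (hS.subset (fun f hf => hf.1) : {f | f ∈ S ∧ ¬ Parallel u f}.Finite).to_subtype
  -- Finitely many nonzero functionals on a real space have a common point where none vanishes. Here
  -- `⟪f, ·⟫` vanishes on `uᗮ` only if `f` is a multiple of `u`.
  obtain ⟨Q, hQ, hQf⟩ := Module.Dual.exists_forall_mem_ne_zero_of_forall_exists (K := ℝ)
    (Submodule.span ℝ {u})ᗮ
    (fun f : {f // f ∈ S ∧ ¬ Parallel u f} => (innerSL ℝ f.1 : _ →L[ℝ] ℝ).toLinearMap) (by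
      rintro ⟨f, hfS, hfu⟩
      by_contra! hcon
      have h1 : f ∈ (Submodule.span ℝ {u})ᗮᗮ := by
        rw [Submodule.mem_orthogonal']
        intro x hx
        simpa using hcon x hx
      rw [Submodule.orthogonal_orthogonal, Submodule.mem_span_singleton] at h1
      obtain ⟨t, ht⟩ := h1
      refine hfu ⟨t, ?_, ht.symm⟩
      rintro rfl
      exact h0 f hfS (by rw [← ht, zero_smul]))
  refine ⟨Q, ?_, fun f hf => ?_⟩
  · rw [real_inner_comm]
    exact Submodule.mem_orthogonal_singleton_iff_inner_right.1 hQ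
  · by_cases hfu : Parallel u f
    · exact Or.inl hfu
    · refine Or.inr ?_
      have := hQf ⟨f, hf, hfu⟩
      rw [real_inner_comm]
      simpa using this

end Parallel

/-! ### Reading off amplitudes, directions and lengths. -/

section Asymptotics

theorem eq_zero_of_forall_abs_le {x y K : ℝ}
    (h : ∀ τ : ℝ, 1 ≤ τ → |x + y / τ ^ 2| ≤ K / τ ^ 4) : x = 0 ∧ y = 0 := by
  have h2 : ∀ C : ℝ, Tendsto (fun τ : ℝ => C / τ ^ 2) atTop (𝓝 0) := fun C =>
    tendsto_const_nhds.div_atTop (tendsto_pow_atTop two_ne_zero)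
  have h4 : Tendsto (fun τ : ℝ => K / τ ^ 4) atTop (𝓝 0) :=
    tendsto_const_nhds.div_atTop (tendsto_pow_atTop four_ne_zero)
  have hx : x = 0 := by
    have h1 : Tendsto (fun τ : ℝ => |x + y / τ ^ 2|) atTop (𝓝 |x|) := by
      simpa using ((h2 y).const_add x).abs
    have h3 := le_of_tendsto_of_tendsto h1 h4 (by
      filter_upwards [eventually_ge_atTop 1] with τ hτ using h τ hτ)
    exact abs_nonpos_iff.1 h3
  refine ⟨hx, ?_⟩
  have h3 := le_of_tendsto_of_tendsto (tendsto_const_nhds (x := |y|)) (h2 K) (by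
    filter_upwards [eventually_ge_atTop 1] with τ hτ
    have hτ0 : 0 < τ := by linarith
    have := h τ hτ
    rw [hx, zero_add, abs_div, abs_of_pos (by positivity : 0 < τ ^ 2), div_le_iff₀ (by positivity)]
      at this
    refine this.trans (le_of_eq ?_)
    field_simp)
  exact abs_nonpos_iff.1 h3

variable {n : ℕ} {ι ι' : Type*} [Fintype ι] [Fintype ι']

/-- No two modes (with signs) are in `1:1` resonance at `Q`. -/
def IsNonresonant (k : ι → Fin n → ℤ) (Q : EuclideanSpace ℝ (Fin n)) : Prop :=
  (∀ i j, inner ℝ Q (intVec (k i) + intVec (k j)) ≠ 0) ∧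
    ∀ i j, i ≠ j → inner ℝ Q (intVec (k i) - intVec (k j)) ≠ 0

theorem eq_and_secondOrderCoeff_eq_of_isNonresonant {a a' : ℝ} {r : ι → ℝ} {r' : ι' → ℝ}
    {k : ι → Fin n → ℤ} {k' : ι' → Fin n → ℤ}
    (h : SameEffectiveHamiltonian (phasePotential a r (fun _ => 0) k)
      (phasePotential a' r' (fun _ => 0) k'))
    {Q : EuclideanSpace ℝ (Fin n)} (hQ : IsNonresonant k Q) (hQ' : IsNonresonant k' Q) :
    a = a' ∧ secondOrderCoeff r k Q = secondOrderCoeff r' k' Q := by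
  obtain ⟨K, hK⟩ := exists_abs_effectiveHamiltonian_phasePotential_sub_le a r k hQ.1 hQ.2
  obtain ⟨K', hK'⟩ := exists_abs_effectiveHamiltonian_phasePotential_sub_le a' r' k' hQ'.1 hQ'.2
  have := eq_zero_of_forall_abs_le (x := a - a')
    (y := secondOrderCoeff r k Q - secondOrderCoeff r' k' Q) (K := K + K') fun τ hτ => by
      have h1 := abs_le.1 (hK τ hτ)
      have h2 := abs_le.1 (hK' τ hτ)
      rw [h] at h1
      rw [add_div, sub_div]
      exact abs_le.2 ⟨by linarith, by linarith⟩
  exact ⟨sub_eq_zero.1 this.1, sub_eq_zero.1 this.2⟩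

open Classical in
/-- The squared amplitudes of the modes parallel to `u`. -/
noncomputable def directionWeight (r : ι → ℝ) (k : ι → Fin n → ℤ)
    (u : EuclideanSpace ℝ (Fin n)) : ℝ :=
  ∑ j, if Parallel u (intVec (k j)) then r j ^ 2 else 0

/-- The second order coefficient blows up at the hyperplanes orthogonal to the modes. -/
theorem tendsto_sq_mul_secondOrderCoeff (r : ι → ℝ) (k : ι → Fin n → ℤ)
    {u Q : EuclideanSpace ℝ (Fin n)} (hu : u ≠ 0) (hQu : inner ℝ Q u = 0)
    (hQ : ∀ j, Parallel u (intVec (k j)) ∨ inner ℝ Q (intVec (k j)) ≠ 0) :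
    Tendsto (fun ε : ℝ => ε ^ 2 * secondOrderCoeff r k (Q + ε • u)) (𝓝[≠] 0)
      (𝓝 (directionWeight r k u / ‖u‖ ^ 2)) := by
  have hu' : ‖u‖ ≠ 0 := norm_ne_zero_iff.2 hu
  simp only [secondOrderCoeff, directionWeight, Finset.mul_sum, Finset.sum_div]
  refine tendsto_finsetSum _ fun j _ => ?_
  split_ifs with hj
  -- The factor `t` cancels between `‖k_j‖²` and `(Q · k_j)²`: this limit sees the direction of a
  -- mode but not its length.
  · obtain ⟨t, ht, hjt⟩ := hj
    refine tendsto_const_nhds.congr' ?_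
    filter_upwards [self_mem_nhdsWithin] with ε hε
    have hε' : ε ≠ 0 := hε
    rw [hjt, real_inner_smul_right, inner_add_left, hQu, real_inner_smul_left,
      real_inner_self_eq_norm_sq, norm_smul, mul_pow, Real.norm_eq_abs, sq_abs, zero_add]
    field_simp
  · have hne := (hQ j).resolve_left hj
    rw [zero_div]
    have hc : ContinuousAt (fun ε : ℝ => ε ^ 2 * (r j ^ 2 * ‖intVec (k j)‖ ^ 2 /
        inner ℝ (Q + ε • u) (intVec (k j)) ^ 2)) 0 := by
      refine ContinuousAt.mul (by fun_prop) (ContinuousAt.div (by fun_prop) (by fun_prop) ?_)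
      simpa using hne
    have := hc.tendsto
    simp only [ne_eq, OfNat.ofNat_ne_zero, not_false_eq_true, zero_pow, zero_mul] at this
    exact this.mono_left nhdsWithin_le_nhds

theorem eventually_inner_add_smul_ne_zero {u Q f : EuclideanSpace ℝ (Fin n)} (hu : u ≠ 0)
    (hQu : inner ℝ Q u = 0) (hf : Parallel u f ∨ inner ℝ Q f ≠ 0) :
    ∀ᶠ ε : ℝ in 𝓝[≠] 0, inner ℝ (Q + ε • u) f ≠ 0 := by
  rcases hf with ⟨t, ht, rfl⟩ | hf
  · filter_upwards [self_mem_nhdsWithin] with ε hε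
    rw [real_inner_smul_right, inner_add_left, hQu, real_inner_smul_left,
      real_inner_self_eq_norm_sq, zero_add]
    have := norm_ne_zero_iff.2 hu
    exact mul_ne_zero ht (mul_ne_zero hε (pow_ne_zero 2 this))
  · have hc : Continuous fun ε : ℝ => inner ℝ (Q + ε • u) f := by fun_prop
    have h1 := (hc.tendsto 0).mono_left (nhdsWithin_le_nhds (s := {0}ᶜ))
    rw [zero_smul, add_zero] at h1
    exact h1.eventually_ne hf

/-- The sums and differences of pairs of modes. -/
def resonanceVectors (k : ι → Fin n → ℤ) : Set (EuclideanSpace ℝ (Fin n)) :=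
  (Set.range fun ij : ι × ι => intVec (k ij.1) + intVec (k ij.2)) ∪
    Set.range fun ij : {ij : ι × ι // ij.1 ≠ ij.2} => intVec (k ij.1.1) - intVec (k ij.1.2)

theorem finite_resonanceVectors (k : ι → Fin n → ℤ) : (resonanceVectors k).Finite :=
  (Set.finite_range _).union (Set.finite_range _)

theorem ne_zero_of_mem_resonanceVectors {κ : Type*} {k : κ → Fin n → ℤ}
    (hk : LinearIndependent ℝ fun j => intVec (k j)) {f : EuclideanSpace ℝ (Fin n)}
    (hf : f ∈ resonanceVectors k) : f ≠ 0 := by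
  rcases hf with ⟨⟨i, j⟩, rfl⟩ | ⟨⟨⟨i, j⟩, hij⟩, rfl⟩
  · intro h
    by_cases hij : i = j
    · subst hij
      dsimp only at h
      rw [← two_smul ℝ, smul_eq_zero] at h
      exact hk.ne_zero i (h.resolve_left two_ne_zero)
    · classical
      have := linearIndependent_iff'.1 hk {i, j} (fun _ => 1)
        (by rw [Finset.sum_pair hij]; simpa using h) i (Finset.mem_insert_self i _)
      exact one_ne_zero this
  · intro h
    exact hij (hk.injective (sub_eq_zero.1 h))

theorem isNonresonant_of_forall_mem {κ : Type*} {k : κ → Fin n → ℤ} {Q : EuclideanSpace ℝ (Fin n)}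
    (h : ∀ f ∈ resonanceVectors k, inner ℝ Q f ≠ 0) : IsNonresonant k Q :=
  ⟨fun i j => h _ (Or.inl ⟨(i, j), rfl⟩), fun i j hij => h _ (Or.inr ⟨⟨(i, j), hij⟩, rfl⟩)⟩

/-- A mode is half of its sum with itself, so genericity for the resonance vectors includes the
modes. -/
theorem parallel_or_inner_ne_zero {κ : Type*} (k : κ → Fin n → ℤ) (j : κ)
    {u Q : EuclideanSpace ℝ (Fin n)}
    (h : ∀ f ∈ resonanceVectors k, Parallel u f ∨ inner ℝ Q f ≠ 0) :
    Parallel u (intVec (k j)) ∨ inner ℝ Q (intVec (k j)) ≠ 0 := by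
  have h1 := h ((2 : ℝ) • intVec (k j)) (Or.inl ⟨(j, j), (two_smul ℝ _).symm⟩)
  rw [real_inner_smul_right] at h1
  exact h1.imp (fun h2 => h2.trans (Parallel.symm ⟨2, two_ne_zero, rfl⟩))
    right_ne_zero_of_mul

/-- The effective Hamiltonian determines the mean and the amplitude along each direction. -/
theorem eq_and_directionWeight_eq {a a' : ℝ} {r : ι → ℝ} {r' : ι' → ℝ}
    {k : ι → Fin n → ℤ} {k' : ι' → Fin n → ℤ}
    (hk : LinearIndependent ℝ fun j => intVec (k j))
    (hk' : LinearIndependent ℝ fun j => intVec (k' j))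
    (h : SameEffectiveHamiltonian (phasePotential a r (fun _ => 0) k)
      (phasePotential a' r' (fun _ => 0) k'))
    {u : EuclideanSpace ℝ (Fin n)} (hu : u ≠ 0) :
    a = a' ∧ directionWeight r k u = directionWeight r' k' u := by
  have hfin := (finite_resonanceVectors k).union (finite_resonanceVectors k')
  -- Take `Q` generic on the hyperplane orthogonal to `u`. Then `Q + ε u` is nonresonant for both
  -- potentials for all small `ε ≠ 0`, and only modes parallel to `u` blow up as `ε → 0`.
  obtain ⟨Q, hQu, hQ⟩ := exists_inner_eq_zero_forall_inner_ne_zero u hfin (by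
    rintro f (hf | hf)
    · exact ne_zero_of_mem_resonanceVectors hk hf
    · exact ne_zero_of_mem_resonanceVectors hk' hf)
  have hev : ∀ᶠ ε : ℝ in 𝓝[≠] 0, a = a' ∧
      secondOrderCoeff r k (Q + ε • u) = secondOrderCoeff r' k' (Q + ε • u) := by
    have := (hfin.eventually_all (l := 𝓝[≠] (0 : ℝ))
      (p := fun f ε => inner ℝ (Q + ε • u) f ≠ 0)).2
      fun f hf => eventually_inner_add_smul_ne_zero hu hQu (hQ f hf)
    filter_upwards [this] with ε hε
    exact eq_and_secondOrderCoeff_eq_of_isNonresonant h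
      (isNonresonant_of_forall_mem fun f hf => hε f (Or.inl hf))
      (isNonresonant_of_forall_mem fun f hf => hε f (Or.inr hf))
  refine ⟨hev.exists.choose_spec.1, ?_⟩
  have t1 := tendsto_sq_mul_secondOrderCoeff r k hu hQu
    fun j => parallel_or_inner_ne_zero k j fun f hf => hQ f (Or.inl hf)
  have t2 := tendsto_sq_mul_secondOrderCoeff r' k' hu hQu
    fun j => parallel_or_inner_ne_zero k' j fun f hf => hQ f (Or.inr hf)
  have t3 := tendsto_nhds_unique t1 (t2.congr' (by
    filter_upwards [hev] with ε hε
    rw [hε.2]))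
  have hu' : ‖u‖ ^ 2 ≠ 0 := pow_ne_zero 2 (norm_ne_zero_iff.2 hu)
  exact (div_left_inj' hu').1 t3

/-- Two modes with nonorthogonal directions: their lengths can only be changed by a common
factor. -/
theorem eq_or_eq_neg_of_sameEffectiveHamiltonian {a : ℝ} {r : Fin 2 → ℝ} {k k' : Fin 2 → Fin n → ℤ}
    (hk : LinearIndependent ℝ fun j => intVec (k j)) (hr : ∀ j, r j ≠ 0)
    (hperp : inner ℝ (intVec (k 0)) (intVec (k 1)) ≠ 0) {t : Fin 2 → ℝ} (ht : ∀ j, t j ≠ 0)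
    (hkt : ∀ j, intVec (k' j) = t j • intVec (k j))
    (h : SameEffectiveHamiltonian (phasePotential a r (fun _ => 0) k)
      (phasePotential a r (fun _ => 0) k')) : t 1 = t 0 ∨ t 1 = - t 0 := by
  by_contra! hcon
  -- At this `Q` the modes `k` are in resonance, whereas `k'` has frequencies `t 0` and `t 1` and is
  -- nonresonant because `t 1 ≠ ± t 0`.
  obtain ⟨Q, hQ⟩ := exists_forall_inner_eq hk fun _ => 1
  replace hQ : ∀ j, inner ℝ Q (intVec (k j)) = 1 := fun j => by rw [real_inner_comm, hQ]
  have hQ' : ∀ j, inner ℝ Q (intVec (k' j)) = t j := fun j => by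
    rw [hkt, real_inner_smul_right, hQ, mul_one]
  have hres : IsNonresonant k' Q := by
    constructor
    · intro i j
      rw [inner_add_right, hQ', hQ']
      intro h0
      fin_cases i <;> fin_cases j <;> simp only [Fin.zero_eta, Fin.mk_one] at h0
      · exact ht 0 (by linarith)
      · exact hcon.2 (by linarith)
      · exact hcon.2 (by linarith)
      · exact ht 1 (by linarith)
    · intro i j hij
      rw [inner_sub_right, hQ', hQ']
      intro h0
      fin_cases i <;> fin_cases j <;> simp only [Fin.zero_eta, Fin.mk_one] at h0
      · exact hij rfl
      · exact hcon.1 (by linarith)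
      · exact hcon.1 (by linarith)
      · exact hij rfl
  -- The factors `t j` cancel in every summand, so the two `τ⁻²` coefficients differ by the resonant
  -- contribution `β` alone.
  have hcoeff : ∀ s : Fin 2 → ℝ, (∀ j, |s j| = |r j|) →
      secondOrderCoeff s k Q = secondOrderCoeff r k' Q := by
    intro s hs
    refine Finset.sum_congr rfl fun j _ => ?_
    rw [hQ, hQ', hkt, norm_smul, mul_pow, Real.norm_eq_abs, sq_abs, ← sq_abs (s j), hs, sq_abs]
    have := ht j
    field_simp
  -- the sign of the second amplitude is at our disposal
  obtain ⟨s, hs, hneg⟩ : ∃ s : Fin 2 → ℝ, (∀ j, |s j| = |r j|) ∧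
      s 0 * s 1 * inner ℝ (intVec (k 0)) (intVec (k 1)) < 0 := by
    have hne := mul_ne_zero (mul_ne_zero (hr 0) (hr 1)) hperp
    rcases hne.lt_or_gt with hlt | hgt
    · exact ⟨r, fun _ => rfl, hlt⟩
    · refine ⟨![r 0, - r 1], fun j => ?_, ?_⟩
      · fin_cases j <;> simp
      · simp only [Matrix.cons_val_zero, Matrix.cons_val_one]
        linarith
  obtain ⟨β, hβ, K, hK⟩ := exists_abs_effectiveHamiltonian_sub_le_of_resonance a s k (Q := Q)
    (by rw [hQ]; exact one_ne_zero) (by rw [hQ, hQ])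
    (fun h0 => zero_ne_one (hk.injective h0)) hneg
  obtain ⟨K', hK'⟩ := exists_abs_effectiveHamiltonian_phasePotential_sub_le a r k' hres.1 hres.2
  have := eq_zero_of_forall_abs_le (x := 0) (y := β) (K := K + K') fun τ hτ => by
    have h1 := abs_le.1 (hK τ hτ)
    have h2 := abs_le.1 (hK' τ hτ)
    rw [effectiveHamiltonian_phasePotential_eq hk a (fun _ => 0) (fun _ => 0) hs, h, hcoeff s hs]
      at h1
    rw [add_div] at h1 ⊢
    exact abs_le.2 ⟨by linarith, by linarith⟩
  exact hβ.ne' this.2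

end Asymptotics

/-! ### Matching modes by their directions. -/

section PhasePotentialComparison

variable {n : ℕ} {ι ι' : Type*} [Fintype ι] [Fintype ι']

theorem directionWeight_eq_sq {r : ι → ℝ} {k : ι → Fin n → ℤ}
    (hk : ∀ i j, i ≠ j → ¬ Parallel (intVec (k i)) (intVec (k j)))
    {u : EuclideanSpace ℝ (Fin n)} {i : ι} (hi : Parallel u (intVec (k i))) :
    directionWeight r k u = r i ^ 2 := by
  rw [directionWeight, Finset.sum_eq_single i, if_pos hi]
  · intro j _ hj
    exact if_neg fun h => hk j i hj (h.symm.trans hi)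
  · simp

theorem exists_parallel_of_directionWeight_eq {r : ι → ℝ} {r' : ι' → ℝ} {k : ι → Fin n → ℤ}
    {k' : ι' → Fin n → ℤ} (hk : ∀ i j, i ≠ j → ¬ Parallel (intVec (k i)) (intVec (k j)))
    (hk' : ∀ i j, i ≠ j → ¬ Parallel (intVec (k' i)) (intVec (k' j))) {i : ι} (hi : r i ≠ 0)
    (h : directionWeight r k (intVec (k i)) = directionWeight r' k' (intVec (k i))) :
    ∃ j, Parallel (intVec (k i)) (intVec (k' j)) ∧ r i ^ 2 = r' j ^ 2 := by
  rw [directionWeight_eq_sq hk (Parallel.refl _)] at h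
  by_cases hex : ∃ j, Parallel (intVec (k i)) (intVec (k' j))
  · obtain ⟨j, hj⟩ := hex
    exact ⟨j, hj, by rw [h, directionWeight_eq_sq hk' hj]⟩
  · push Not at hex
    rw [directionWeight, Finset.sum_eq_zero fun j _ => if_neg (hex j)] at h
    exact absurd h (pow_ne_zero 2 hi)

/-- Modes of zero amplitude have unrelated directions in the two potentials; they must be discarded
before separated formulas can be compared. -/
theorem phasePotential_subtype (a : ℝ) (r φ : ι → ℝ) (k : ι → Fin n → ℤ) (q : ι → Prop)
    [DecidablePred q] (h : ∀ j, ¬ q j → r j = 0) :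
    phasePotential a r φ k = phasePotential a (fun j : {j // q j} => r j) (fun j => φ j)
      (fun j => k j) := by
  funext x
  unfold phasePotential
  congr 1
  refine Eq.trans ?_ (Finset.sum_subtype (Finset.univ.filter q) (by simp)
    (fun j => 2 * r j * Real.cos (inner ℝ ((2 * Real.pi) • intVec (k j)) x + φ j)))
  rw [Finset.sum_filter]
  refine Finset.sum_congr rfl fun j _ => ?_
  split_ifs with hj
  · rfl
  · rw [h j hj]
    ring

end PhasePotentialComparison

/-! ### Conclusions for trigonometric potentials. -/

namespace ModePotential

variable {n m : ℕ}

theorem V_eq_phasePotential (P : ModePotential n m) :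
    P.V = phasePotential P.a (fun j => ‖P.amp j‖) (fun j => (P.amp j).arg) P.k := by
  funext x
  unfold V expansion phasePotential
  rw [Complex.add_re, Complex.ofReal_re, Complex.re_sum]
  congr 1
  refine Finset.sum_congr rfl fun j _ => ?_
  rw [real_inner_smul_left]
  set θ : ℝ := 2 * Real.pi * inner ℝ (intVec (P.k j)) x
  have h1 : (starRingEnd ℂ) (P.amp j) * Complex.exp (-(Complex.I * θ))
      = (starRingEnd ℂ) (P.amp j * Complex.exp (Complex.I * θ)) := by
    rw [map_mul, ← Complex.exp_conj, map_mul, Complex.conj_I, Complex.conj_ofReal, neg_mul]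
  have h2 : P.amp j * Complex.exp (Complex.I * θ)
      = ‖P.amp j‖ * Complex.exp (((θ + (P.amp j).arg : ℝ) : ℂ) * Complex.I) := by
    conv_lhs => rw [← Complex.norm_mul_exp_arg_mul_I (P.amp j)]
    rw [mul_assoc, ← Complex.exp_add]
    congr 2
    push_cast
    ring
  rw [h1, Complex.add_re, Complex.conj_re, h2, Complex.re_ofReal_mul, Complex.exp_ofReal_mul_I_re]
  ring

theorem linearIndependent_one (P : ModePotential n 1) :
    LinearIndependent ℝ fun j => intVec (P.k j) := by
  rw [linearIndependent_unique_iff]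
  exact intVec_ne_zero (P.k_ne_zero _)

theorem linearIndependent_two (P : ModePotential n 2) :
    LinearIndependent ℝ fun j => intVec (P.k j) := by
  rw [linearIndependent_fin2]
  refine ⟨intVec_ne_zero (P.k_ne_zero _), fun t ht => ?_⟩
  have ht0 : t ≠ 0 := by
    rintro rfl
    exact intVec_ne_zero (P.k_ne_zero 0) (by rw [← ht, zero_smul])
  exact P.not_parallel 1 0 one_ne_zero ⟨t, ht0, ht.symm⟩

theorem effectiveHamiltonian_V {P : ModePotential n m}
    (hk : LinearIndependent ℝ fun j => intVec (P.k j)) (p : EuclideanSpace ℝ (Fin n)) :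
    effectiveHamiltonian kinetic P.V p = effectiveHamiltonian kinetic
      (phasePotential P.a (fun j => ‖P.amp j‖) (fun _ => 0) P.k) p := by
  rw [V_eq_phasePotential]
  exact effectiveHamiltonian_phasePotential_eq hk _ _ _ (fun _ => rfl) p

theorem sameEffectiveHamiltonian_of_rationallyEquivalent {P₁ P₂ : ModePotential n m}
    (hk : LinearIndependent ℝ fun j => intVec (P₂.k j))
    (h : RationallyEquivalent P₁.V P₂.V) : SameEffectiveHamiltonian P₁.V P₂.V := by
  obtain ⟨c, hc, x₀, h⟩ := h
  have huc : ∀ P : ModePotential n m, UniformContinuous P.V := fun P => by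
    rw [V_eq_phasePotential]; exact uniformContinuous_phasePotential _ _ _ _
  have hper : ∀ P : ModePotential n m, IsZPeriodic P.V := fun P => by
    rw [V_eq_phasePotential]; exact isZPeriodic_phasePotential _ _ _ _
  rcases hc.lt_or_gt with hneg | hpos
  · -- the potential `V₂` is even up to a translation
    obtain ⟨x₁, hx₁⟩ := exists_phasePotential_comp_add hk P₂.a (fun j => ‖P₂.amp j‖)
      (fun j => (P₂.amp j).arg) (fun j => - (P₂.amp j).arg)
    have heven : ∀ y, P₂.V (-y) = P₂.V (y + x₁) := fun y => by
      rw [V_eq_phasePotential, phasePotential_neg_apply, hx₁]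
    refine effectiveHamiltonian_eq_of_rescale (huc _) (hper _) (huc _) (hper _)
      (neg_pos.2 hneg) (x₀ := -x₀ + x₁) fun x => ?_
    rw [h x, ← add_assoc, ← heven]
    congr 1
    push_cast
    rw [inv_neg, neg_smul]
    abel
  · exact effectiveHamiltonian_eq_of_rescale (huc _) (hper _) (huc _) (hper _) hpos h

/-- The rescaling matches the modes up to sign, a sign is absorbed by evenness of the cosine, and
the phases are matched by a translation, available because the modes are independent. -/
theorem rationallyEquivalent_of_parallel {P₁ P₂ : ModePotential n m}
    (hk : LinearIndependent ℝ fun j => intVec (P₁.k j)) (ha : P₁.a = P₂.a)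
    (σ : Equiv.Perm (Fin m)) (hσ : ∀ j, ‖P₁.amp j‖ = ‖P₂.amp (σ j)‖) {c : ℚ} (hc : c ≠ 0)
    (hck : ∀ j, P₁.amp j ≠ 0 → intVec (P₂.k (σ j)) = (c : ℝ) • intVec (P₁.k j) ∨
      intVec (P₂.k (σ j)) = -((c : ℝ) • intVec (P₁.k j))) :
    RationallyEquivalent P₁.V P₂.V := by
  classical
  have hc' : (c : ℝ) ≠ 0 := by exact_mod_cast hc
  set s : Fin m → ℝ := fun j =>
    if intVec (P₂.k (σ j)) = (c : ℝ) • intVec (P₁.k j) then 1 else -1 with hs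
  obtain ⟨x₀, hx₀⟩ := exists_forall_inner_eq hk fun j =>
    ((P₁.amp j).arg - s j * (P₂.amp (σ j)).arg) / (2 * Real.pi * c)
  refine ⟨c, hc, x₀, fun x => ?_⟩
  rw [V_eq_phasePotential, V_eq_phasePotential]
  unfold phasePotential
  rw [ha]
  congr 1
  refine Eq.trans (Finset.sum_congr rfl fun j _ => ?_) (Equiv.sum_comp σ _)
  beta_reduce
  rw [← hσ j]
  by_cases hj : P₁.amp j = 0
  · simp [hj]
  congr 1
  have hx₀j := hx₀ j
  have hpi := Real.pi_pos.ne'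
  have key : 2 * Real.pi * c * inner ℝ (intVec (P₁.k j)) x₀
      = (P₁.amp j).arg - s j * (P₂.amp (σ j)).arg := by
    rw [hx₀j]
    field_simp
  rw [real_inner_smul_left, real_inner_smul_left, inner_add_right, real_inner_smul_right]
  by_cases h1 : intVec (P₂.k (σ j)) = (c : ℝ) • intVec (P₁.k j)
  · simp only [hs, if_pos h1] at key
    rw [h1, real_inner_smul_left, real_inner_smul_left, inv_mul_cancel_left₀ hc']
    congr 1
    linarith
  · simp only [hs, if_neg h1] at key
    rw [(hck j hj).resolve_left h1, inner_neg_left, inner_neg_left, real_inner_smul_left,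
      real_inner_smul_left, mul_neg, inv_mul_cancel_left₀ hc', ← Real.cos_neg]
    congr 1
    linarith

theorem sameEffectiveHamiltonian_phasePotential {P₁ P₂ : ModePotential n m}
    (hk₁ : LinearIndependent ℝ fun j => intVec (P₁.k j))
    (hk₂ : LinearIndependent ℝ fun j => intVec (P₂.k j))
    (h : SameEffectiveHamiltonian P₁.V P₂.V) :
    SameEffectiveHamiltonian (phasePotential P₁.a (fun j => ‖P₁.amp j‖) (fun _ => 0) P₁.k)
      (phasePotential P₂.a (fun j => ‖P₂.amp j‖) (fun _ => 0) P₂.k) :=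
  fun p => by rw [← effectiveHamiltonian_V hk₁, ← effectiveHamiltonian_V hk₂, h]

/-- The effective Hamiltonian determines the mean, the amplitudes and the directions of the modes. -/
theorem exists_perm_of_sameEffectiveHamiltonian {P₁ P₂ : ModePotential n m} (hm : 0 < m)
    (hk₁ : LinearIndependent ℝ fun j => intVec (P₁.k j))
    (hk₂ : LinearIndependent ℝ fun j => intVec (P₂.k j))
    (h : SameEffectiveHamiltonian P₁.V P₂.V) :
    P₁.a = P₂.a ∧ ∃ σ : Equiv.Perm (Fin m), ∀ j,
      (P₁.amp j ≠ 0 → Parallel (intVec (P₁.k j)) (intVec (P₂.k (σ j)))) ∧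
      ‖P₁.amp j‖ = ‖P₂.amp (σ j)‖ := by
  have hw := fun {u : EuclideanSpace ℝ (Fin n)} (hu : u ≠ 0) => eq_and_directionWeight_eq hk₁ hk₂
    (sameEffectiveHamiltonian_phasePotential hk₁ hk₂ h) hu
  refine ⟨(hw (intVec_ne_zero (P₁.k_ne_zero ⟨0, hm⟩))).1, ?_⟩
  have h₁ : ∀ i : {i // P₁.amp i ≠ 0}, ∃ j : {j // P₂.amp j ≠ 0},
      Parallel (intVec (P₁.k i)) (intVec (P₂.k j)) ∧ ‖P₁.amp i‖ = ‖P₂.amp j‖ := by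
    rintro ⟨i, hi⟩
    obtain ⟨j, hj, hij⟩ := exists_parallel_of_directionWeight_eq
      (r := fun i => ‖P₁.amp i‖) P₁.not_parallel P₂.not_parallel
      (norm_ne_zero_iff.2 hi) (hw (intVec_ne_zero (P₁.k_ne_zero i))).2
    have hij' := (sq_eq_sq₀ (norm_nonneg _) (norm_nonneg _)).1 hij
    refine ⟨⟨j, fun h0 => hi ?_⟩, hj, hij'⟩
    rwa [h0, norm_zero, norm_eq_zero] at hij'
  have h₂ : ∀ j : {j // P₂.amp j ≠ 0}, ∃ i : {i // P₁.amp i ≠ 0},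
      Parallel (intVec (P₂.k j)) (intVec (P₁.k i)) := by
    rintro ⟨j, hj⟩
    obtain ⟨i, hi, hij⟩ := exists_parallel_of_directionWeight_eq
      (r := fun i => ‖P₂.amp i‖) P₂.not_parallel P₁.not_parallel
      (norm_ne_zero_iff.2 hj) (hw (intVec_ne_zero (P₂.k_ne_zero j))).2.symm
    have hij' := (sq_eq_sq₀ (norm_nonneg _) (norm_nonneg _)).1 hij
    refine ⟨⟨i, fun h0 => hj ?_⟩, hi⟩
    rwa [h0, norm_zero, norm_eq_zero] at hij'
  choose f hf using h₁
  -- Distinct modes of one potential are never parallel, so parallelism matches the modes of nonzero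
  -- amplitude bijectively.
  have hbij : Function.Bijective f := by
    constructor
    · intro i i' hii'
      by_contra hne
      have h1 := (hf i).1
      rw [hii'] at h1
      exact P₁.not_parallel i i' (fun h0 => hne (Subtype.ext h0)) (h1.trans (hf i').1.symm)
    · intro j
      obtain ⟨i, hi⟩ := h₂ j
      refine ⟨i, ?_⟩
      by_contra hne
      exact P₂.not_parallel j (f i) (fun h0 => hne (Subtype.ext h0.symm)) (hi.trans (hf i).1)
  classical
  -- The extension sends zero amplitudes to zero amplitudes, so the norms agree there too.
  refine ⟨(Equiv.ofBijective f hbij).extendSubtype, fun j => ?_⟩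
  by_cases hj : P₁.amp j = 0
  · have h3 := (Equiv.ofBijective f hbij).extendSubtype_not_mem j (not_not.2 hj)
    rw [not_not] at h3
    exact ⟨fun h0 => absurd hj h0, by rw [hj, h3]⟩
  · rw [Equiv.extendSubtype_apply_of_mem _ j hj]
    exact ⟨fun _ => (hf ⟨j, hj⟩).1, (hf ⟨j, hj⟩).2⟩

/-- The separated formula depends on a mode only through its amplitude and its unit direction, and
the orientation is irrelevant since cosine is even. -/
theorem sameEffectiveHamiltonian_of_orthogonal {P₁ P₂ : ModePotential n m}
    (hk₁ : LinearIndependent ℝ fun j => intVec (P₁.k j))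
    (hk₂ : LinearIndependent ℝ fun j => intVec (P₂.k j))
    (hperp : ∀ i j, i ≠ j → inner ℝ (intVec (P₁.k i)) (intVec (P₁.k j)) = 0) (ha : P₁.a = P₂.a)
    (σ : Equiv.Perm (Fin m)) (hσ : ∀ j,
      (P₁.amp j ≠ 0 → Parallel (intVec (P₁.k j)) (intVec (P₂.k (σ j)))) ∧
      ‖P₁.amp j‖ = ‖P₂.amp (σ j)‖) : SameEffectiveHamiltonian P₁.V P₂.V := by
  classical
  intro p
  rw [effectiveHamiltonian_V hk₁, effectiveHamiltonian_V hk₂, ← ha]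
  choose t ht0 ht using fun j : {j // P₁.amp j ≠ 0} => (hσ j).1 j.2
  -- reorient the modes of the second potential
  set l : {j // P₁.amp j ≠ 0} → Fin n → ℤ := fun j =>
    if 0 < t j then P₂.k (σ j) else -P₂.k (σ j) with hl
  have hlt : ∀ j, intVec (l j) = |t j| • intVec (P₁.k j) := by
    intro j
    simp only [hl]
    split_ifs with h0
    · rw [ht, abs_of_pos h0]
    · have h1 : intVec (-P₂.k (σ j)) = -intVec (P₂.k (σ j)) := by ext i; simp [intVec]
      rw [h1, ht, abs_of_nonpos (not_lt.1 h0), neg_smul]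
  have hV₂ : phasePotential P₁.a (fun j => ‖P₂.amp j‖) (fun _ => 0) P₂.k
      = phasePotential P₁.a (fun j : {j // P₁.amp j ≠ 0} => ‖P₁.amp j‖) (fun _ => 0) l := by
    have h1 : phasePotential P₁.a (fun j => ‖P₂.amp j‖) (fun _ => 0) P₂.k
        = phasePotential P₁.a (fun j => ‖P₁.amp j‖) (fun _ => 0) fun j => P₂.k (σ j) := by
      funext x
      unfold phasePotential
      rw [← Equiv.sum_comp σ]
      simp only [(hσ _).2]
    rw [h1, phasePotential_subtype _ _ _ _ (fun j => P₁.amp j ≠ 0) (by simp)]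
    funext x
    unfold phasePotential
    congr 1
    refine Finset.sum_congr rfl fun j _ => ?_
    congr 1
    simp only [hl, add_zero]
    split_ifs with h0
    · rfl
    · have h1 : intVec (-P₂.k (σ j)) = -intVec (P₂.k (σ j)) := by ext i; simp [intVec]
      rw [h1, smul_neg, inner_neg_left, Real.cos_neg]
  rw [hV₂, phasePotential_subtype _ _ _ _ (fun j => P₁.amp j ≠ 0) (by simp),
    effectiveHamiltonian_phasePotential_of_orthogonal
      (k := fun j : {j // P₁.amp j ≠ 0} => P₁.k j) (fun j => intVec_ne_zero (P₁.k_ne_zero j))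
      (fun i j hij => hperp i j fun h0 => hij (Subtype.ext h0)),
    effectiveHamiltonian_phasePotential_of_orthogonal
      (fun j => by
        rw [hlt]
        exact smul_ne_zero (abs_ne_zero.2 (ht0 j)) (intVec_ne_zero (P₁.k_ne_zero j)))
      (fun i j hij => by
        rw [hlt, hlt, real_inner_smul_left, real_inner_smul_right,
          hperp i j fun h0 => hij (Subtype.ext h0), mul_zero, mul_zero])]
  congr 1
  refine Finset.sum_congr rfl fun j _ => ?_
  have h1 : inner ℝ p (intVec (l j)) / ‖intVec (l j)‖
      = inner ℝ p (intVec (P₁.k j)) / ‖intVec (P₁.k j)‖ := by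
    have := abs_ne_zero.2 (ht0 j)
    rw [hlt, real_inner_smul_right, norm_smul, Real.norm_eq_abs, abs_abs,
      mul_div_mul_left _ _ this]
  rw [h1]

theorem rationallyEquivalent_of_sameEffectiveHamiltonian_one {P₁ P₂ : ModePotential n 1}
    (h : SameEffectiveHamiltonian P₁.V P₂.V) : RationallyEquivalent P₁.V P₂.V := by
  obtain ⟨ha, σ, hσ⟩ := exists_perm_of_sameEffectiveHamiltonian one_pos P₁.linearIndependent_one
    P₂.linearIndependent_one h
  by_cases h0 : P₁.amp 0 = 0
  · exact rationallyEquivalent_of_parallel P₁.linearIndependent_one ha σ (fun j => (hσ j).2)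
      one_ne_zero fun j hj => absurd (Subsingleton.elim j 0 ▸ h0) hj
  · obtain ⟨q, hq, hqk⟩ := ((hσ 0).1 h0).exists_rat (P₁.k_ne_zero 0)
    refine rationallyEquivalent_of_parallel P₁.linearIndependent_one ha σ (fun j => (hσ j).2) hq
      fun j _ => Or.inl ?_
    rw [Subsingleton.elim j 0, hqk]

theorem rationallyEquivalent_of_sameEffectiveHamiltonian_two {P₁ P₂ : ModePotential n 2}
    (hperp : inner ℝ (intVec (P₁.k 0)) (intVec (P₁.k 1)) ≠ 0)
    (h : SameEffectiveHamiltonian P₁.V P₂.V) : RationallyEquivalent P₁.V P₂.V := by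
  have hk₁ := P₁.linearIndependent_two
  have hk₂ := P₂.linearIndependent_two
  obtain ⟨ha, σ, hσ⟩ := exists_perm_of_sameEffectiveHamiltonian two_pos hk₁ hk₂ h
  have hrat : ∀ j, P₁.amp j ≠ 0 → ∃ q : ℚ, q ≠ 0 ∧
      intVec (P₂.k (σ j)) = (q : ℝ) • intVec (P₁.k j) := fun j hj =>
    ((hσ j).1 hj).exists_rat (P₁.k_ne_zero j)
  -- If an amplitude vanishes, at most one ratio of lengths matters and it can serve as `c`; the
  -- resonance argument is needed only when both are nonzero.
  by_cases h0 : P₁.amp 0 = 0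
  · by_cases h1 : P₁.amp 1 = 0
    · refine rationallyEquivalent_of_parallel hk₁ ha σ (fun j => (hσ j).2) one_ne_zero
        fun j hj => absurd ?_ hj
      fin_cases j
      · exact h0
      · exact h1
    · obtain ⟨q, hq, hqk⟩ := hrat 1 h1
      refine rationallyEquivalent_of_parallel hk₁ ha σ (fun j => (hσ j).2) hq fun j hj => ?_
      fin_cases j
      · exact absurd h0 hj
      · exact Or.inl hqk
  · obtain ⟨q, hq, hqk⟩ := hrat 0 h0
    refine rationallyEquivalent_of_parallel hk₁ ha σ (fun j => (hσ j).2) hq fun j hj => ?_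
    fin_cases j
    · exact Or.inl hqk
    · obtain ⟨q', hq', hqk'⟩ := hrat 1 hj
      -- Reindexing the second potential by `σ` gives both potentials the same mean and amplitudes,
      -- with modes differing only by the factors `q` and `q'`.
      have hsame : SameEffectiveHamiltonian
          (phasePotential P₁.a (fun j => ‖P₁.amp j‖) (fun _ => 0) P₁.k)
          (phasePotential P₁.a (fun j => ‖P₁.amp j‖) (fun _ => 0) fun j => P₂.k (σ j)) := by
        intro p
        rw [← effectiveHamiltonian_V hk₁, h p, effectiveHamiltonian_V hk₂]
        congr 1
        funext x
        unfold phasePotential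
        rw [← Equiv.sum_comp σ, ha]
        simp only [(hσ _).2]
      have := eq_or_eq_neg_of_sameEffectiveHamiltonian (t := ![(q : ℝ), q']) hk₁
        (fun i => by
          rw [norm_ne_zero_iff]
          fin_cases i
          · exact h0
          · exact hj) hperp
        (fun i => by
          fin_cases i
          · exact Rat.cast_ne_zero.2 hq
          · exact Rat.cast_ne_zero.2 hq')
        (fun i => by
          fin_cases i
          · exact hqk
          · exact hqk') hsame
      simp only [Matrix.cons_val_zero, Matrix.cons_val_one] at this
      rcases this with hqq | hqq
      · exact Or.inl (by rw [← hqq]; exact hqk')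
      · refine Or.inr ?_
        rw [← neg_smul, ← hqq]
        exact hqk'

end ModePotential

end InverseHomogenization

theorem theorem1p3 (n : ℕ) :
    (∀ P₁ P₂ : InverseHomogenization.ModePotential n 1,
      InverseHomogenization.SameEffectiveHamiltonian P₁.V P₂.V ↔
        InverseHomogenization.RationallyEquivalent P₁.V P₂.V) ∧
    (∀ P₁ P₂ : InverseHomogenization.ModePotential n 2,
      (inner ℝ (InverseHomogenization.intVec (P₁.k 0))
          (InverseHomogenization.intVec (P₁.k 1)) = 0 →
        (InverseHomogenization.SameEffectiveHamiltonian P₁.V P₂.V ↔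
          P₁.a = P₂.a ∧ ∃ σ : Equiv.Perm (Fin 2), ∀ j,
            (P₁.amp j ≠ 0 → InverseHomogenization.Parallel
              (InverseHomogenization.intVec (P₁.k j))
              (InverseHomogenization.intVec (P₂.k (σ j)))) ∧
            ‖P₁.amp j‖ = ‖P₂.amp (σ j)‖)) ∧
      (inner ℝ (InverseHomogenization.intVec (P₁.k 0))
          (InverseHomogenization.intVec (P₁.k 1)) ≠ 0 →
        (InverseHomogenization.SameEffectiveHamiltonian P₁.V P₂.V ↔
          InverseHomogenization.RationallyEquivalent P₁.V P₂.V))) := by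
  open InverseHomogenization ModePotential in
  refine ⟨fun P₁ P₂ => ⟨rationallyEquivalent_of_sameEffectiveHamiltonian_one,
    sameEffectiveHamiltonian_of_rationallyEquivalent P₂.linearIndependent_one⟩,
    fun P₁ P₂ => ⟨fun hperp => ⟨exists_perm_of_sameEffectiveHamiltonian two_pos
      P₁.linearIndependent_two P₂.linearIndependent_two, ?_⟩, fun hperp =>
      ⟨rationallyEquivalent_of_sameEffectiveHamiltonian_two hperp,
        sameEffectiveHamiltonian_of_rationallyEquivalent P₂.linearIndependent_two⟩⟩⟩
  rintro ⟨ha, σ, hσ⟩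
  refine InverseHomogenization.ModePotential.sameEffectiveHamiltonian_of_orthogonal
    P₁.linearIndependent_two P₂.linearIndependent_two (fun i j hij => ?_) ha σ hσ
  fin_cases i <;> fin_cases j
  · exact absurd rfl hij
  · exact hperp
  · rw [real_inner_comm]
    exact hperp
  · exact absurd rfl hij
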